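/- Consider a single-server queue modulated by an environment $Z$, an irreducible continuous-time Markov chain on $\{1,\dots,D\}$ with generator $Q$ and invariant distribution $\pi$. While $Z=d$, customers arrive according to a Poisson process of rate $\lambda_d\ge 0$ and the server has capacity $c_d\ge 0$. A customer who arrives while $Z=d$ has an independent service requirement with distribution $H_d$ on $[0,\infty)$ with mean $h_{d1}$ and finite second moment $h_{d2}$, which does not change afterwards. Each customer may also carry a class, possibly correlated with the service requirement, with a joint law that depends on $d$. The service discipline is any work-conserving discipline that does not depend on the state of the environment. The workload $W$ is the total residual service requirement of the customers present; it jumps up by the service requirement of each arriving customer and decreases at rate $c_{Z}$ as long as it is positive. Let $c_\infty=\sum_d\pi_dc_d>0$ and $\rho_\infty=\sum_d\pi_d\lambda_dh_{d1}/c_\infty>0$. Put $\hat\lambda_d=\lambda_d/\rho_\infty$, and for real $N>1$ let $\lambda^{(N)}_d=\hat\lambda_d(1-1/N)$. Let $(W^{(N)},Z^{(N)})$ be the workload and environment, in steady state, of the queue with arrival rates $\lambda^{(N)}_d$ (all other parameters unchanged), and let $p^{(N)}_{0,d}=\mathbb P(W^{(N)}=0,\,Z^{(N)}=d)$. Then $\mathbb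 E W^{(N)}<\infty$ for every $N>1$; $p^{(N)}_{0,d}\to0$ as $N\to\infty$ for every $d$; the linear system $[Qa]_d=c_d-\hat\lambda_dh_{d1}$, $d=1,\dots,D$, has a solution $a\in\mathbb R^D$; and for every solution $a$ of it $$\lim_{N\to\infty}\frac1N\,\mathbb E W^{(N)}=\frac1{c_\infty}\sum_{d=1}^D\pi_d\Bigl[\tfrac12\hat\lambda_dh_{d2}+a_d\bigl(\hat\lambda_dh_{d1}-c_d\bigr)\Bigr].$$ -/

import Mathlib

open MeasureTheory ProbabilityTheory Filter Topology
open scoped NNReal ENNReal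

namespace ModulatedQueue

universe u v

/-- `Q` is the infinitesimal generator of a continuous-time Markov chain on `Fin D`. -/
structure IsGenerator {D : ℕ} (Q : Matrix (Fin D) (Fin D) ℝ) : Prop where
  off_diag_nonneg : ∀ d l, d ≠ l → 0 ≤ Q d l
  row_sum : ∀ d, ∑ l, Q d l = 0

/-- Every state can be reached from every other one through transitions of positive rate. -/
def IsIrreducible {D : ℕ} (Q : Matrix (Fin D) (Fin D) ℝ) : Prop :=
  ∀ d l, Relation.ReflTransGen (fun i j => i ≠ j ∧ 0 < Q i j) d l

/-- `p` is an invariant probability vector of the generator `Q`. -/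
structure IsInvariant {D : ℕ} (Q : Matrix (Fin D) (Fin D) ℝ) (p : Fin D → ℝ) : Prop where
  nonneg : ∀ d, 0 ≤ p d
  sum_eq_one : ∑ d, p d = 1
  balance : Matrix.vecMul p Q = 0

/-- The parameters of a single-server queue modulated by an environment with states `Fin D`.
A customer is a pair (class, service requirement) in `K × ℝ≥0`; `K` is a one-point type in the
single-class queue. The marginal on `ℝ≥0` of `customerLaw d` is the service requirement
distribution `H_d`. -/
structure Params (D : ℕ) (K : Type v) [MeasurableSpace K] where
  /-- the generator `Q` of the environment -/
  gen : Matrix (Fin D) (Fin D) ℝ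
  /-- the Poisson arrival rate `λ_d` in state `d` -/
  rate : Fin D → ℝ
  /-- the service capacity `c_d` in state `d` -/
  cap : Fin D → ℝ
  /-- the law of (class, service requirement) of a customer who arrives in state `d` -/
  customerLaw : Fin D → Measure (K × ℝ≥0)

namespace Params

variable {D : ℕ} {K : Type v} [MeasurableSpace K] (M : Params D K)

/-- The first moment `h_{d1}` of the service requirement. -/
noncomputable def h1 (d : Fin D) : ℝ := ∫ z, (z.2 : ℝ) ∂(M.customerLaw d)

/-- The second moment `h_{d2}` of the service requirement. -/
noncomputable def h2 (d : Fin D) : ℝ := ∫ z, (z.2 : ℝ) ^ 2 ∂(M.customerLaw d)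

/-- The average capacity `c_∞`; here `p` is the invariant distribution of the environment. -/
def capAvg (p : Fin D → ℝ) : ℝ := ∑ d, p d * M.cap d

/-- The traffic intensity `ρ_∞`. -/
noncomputable def load (p : Fin D → ℝ) : ℝ := (∑ d, p d * M.rate d * M.h1 d) / M.capAvg p

/-- The limiting arrival rate `λ_d / ρ_∞`. -/
noncomputable def rateHat (p : Fin D → ℝ) (d : Fin D) : ℝ := M.rate d / M.load p

/-- The queue with arrival rates `(λ_d / ρ_∞) (1 - 1 / N)`, all else unchanged. -/
noncomputable def scaled (p : Fin D → ℝ) (N : ℝ) : Params D K :=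
  { M with rate := fun d => M.rate d / M.load p * (1 - 1 / N) }

/-- The standing assumptions on the parameters. -/
structure IsAdmissible : Prop where
  generator : IsGenerator M.gen
  irreducible : IsIrreducible M.gen
  rate_nonneg : ∀ d, 0 ≤ M.rate d
  cap_nonneg : ∀ d, 0 ≤ M.cap d
  prob : ∀ d, IsProbabilityMeasure (M.customerLaw d)
  second_moment : ∀ d, Integrable (fun z : K × ℝ≥0 => (z.2 : ℝ) ^ 2) (M.customerLaw d)

end Params

/-- A (work-conserving, possibly randomized) service discipline that does not depend on the
environment. A point of `State` describes the content of the queue together with everything that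
the server keeps track of: order of arrival, classes, attained service, and so on. The environment
enters only through the speed at which capacity is delivered: neither `serve` nor `join` sees it.
Subtraction in `ℝ≥0` is `max (a - b) 0`. -/
structure ServiceDiscipline (K : Type v) [MeasurableSpace K] where
  State : Type u
  [measurableSpace : MeasurableSpace State]
  /-- the residual service requirements of the customers who are present -/
  residual : State → Multiset ℝ≥0
  measurable_residual_sum : Measurable fun x => (residual x).sum
  /-- `serve (b, x)`: law of the state that is reached from `x`, if there are no arrivals, once
  the server has made an amount `b` of capacity available -/
  serve : Kernel (ℝ≥0 × State) State
  serve_markov : IsMarkovKernel serve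
  serve_zero : ∀ x, serve (0, x) = Measure.dirac x
  serve_add : ∀ b b' x, serve (b + b', x) = (serve (b, x)).bind fun y => serve (b', y)
  /-- work conservation: the server works at full capacity as long as there is work -/
  serve_residual : ∀ b x, ∀ᵐ y ∂(serve (b, x)), (residual y).sum = (residual x).sum - b
  /-- `join (x, z)`: law of the state right after customer `z` has joined a queue in state `x` -/
  join : Kernel (State × (K × ℝ≥0)) State
  join_markov : IsMarkovKernel join
  join_residual : ∀ x z, ∀ᵐ y ∂(join (x, z)), residual y = z.2 ::ₘ residual x

attribute [instance] ServiceDiscipline.measurableSpace ServiceDiscipline.serve_markov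
  ServiceDiscipline.join_markov

/-- The workload: the total residual service requirement. -/
def ServiceDiscipline.workload {K : Type v} [MeasurableSpace K] (S : ServiceDiscipline.{u} K)
    (x : S.State) : ℝ≥0 := (S.residual x).sum

section Dynamics

variable {D : ℕ} {K : Type v} [MeasurableSpace K] (M : Params D K) (S : ServiceDiscipline.{u} K)

/-- Total rate of the events (an arrival or a jump of the environment) in state `d`. -/
def eventRate (d : Fin D) : ℝ := M.rate d + ∑ l ∈ Finset.univ.erase d, M.gen d l

/-- `transitionAux n t f (x, d)` is the expectation of `f (X t, Z t)` on the event that exactly `n`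
events (arrivals and jumps of the environment) occur in `[0, t]`, if `(X 0, Z 0) = (x, d)`. While
the environment is in state `d`, capacity is delivered at speed `c_d`, customers arrive at rate
`λ_d`, and the environment jumps to `l ≠ d` at rate `q_{dl}`. The recursion is on the first
event; `s` is its time. -/
noncomputable def transitionAux : ℕ → ℝ → (S.State × Fin D → ℝ≥0∞) → S.State × Fin D → ℝ≥0∞
  | 0, t, f, (x, d) =>
      ENNReal.ofReal (Real.exp (-(eventRate M d * t))) *
        ∫⁻ y, f (y, d) ∂(S.serve ((M.cap d * t).toNNReal, x))
  | n + 1, t, f, (x, d) =>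
      ∫⁻ s in Set.Icc 0 t, ENNReal.ofReal (Real.exp (-(eventRate M d * s))) *
        ∫⁻ y,
          (ENNReal.ofReal (M.rate d) *
              ∫⁻ z, ∫⁻ y', transitionAux n (t - s) f (y', d) ∂(S.join (y, z)) ∂(M.customerLaw d)
            + ∑ l ∈ Finset.univ.erase d,
                ENNReal.ofReal (M.gen d l) * transitionAux n (t - s) f (y, l))
          ∂(S.serve ((M.cap d * s).toNNReal, x))

/-- The transition operator `f ↦ E[f (X t, Z t) | (X 0, Z 0) = ·]` of the Markov process formed by
the queue and its environment. -/
noncomputable def transition (t : ℝ) (f : S.State × Fin D → ℝ≥0∞) (q : S.State × Fin D) : ℝ≥0∞ :=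
  ∑' n, transitionAux M S n t f q

/-- If `(X 0, Z 0)` has law `μ`, the process (workload, environment) is in steady state: its law at
time `t` is the same for all `t ≥ 0`. -/
structure IsSteadyState (μ : Measure (S.State × Fin D)) : Prop where
  prob : IsProbabilityMeasure μ
  stationary : ∀ t : ℝ, 0 ≤ t → ∀ f : ℝ≥0 × Fin D → ℝ≥0∞, Measurable f →
    ∫⁻ q, transition M S t (fun r => f (S.workload r.1, r.2)) q ∂μ
      = ∫⁻ q, f (S.workload q.1, q.2) ∂μ

end Dynamics

end ModulatedQueue

/-! Work conservation makes the workload, jointly with the environment, evolve on its own whatever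
the discipline, so everything can be read off from the transforms φ_k(θ) = E[exp(-θW); Z = k]. Over
a short time t, two or more events have probability O(t²). Stationarity, divided by t as t → 0,
therefore yields c_k θ (φ_k(θ) - p_{0,k}) - λ_k (1 - Ĥ_k(θ)) φ_k(θ) + ∑_d φ_d(θ) Q_{dk} = 0, where
Ĥ_k is the Laplace transform of the service requirement (`IsSteadyState.balance`).

The rest is algebra with this equation. At θ = 0 it identifies φ(0) with the invariant distribution.
Pairing it with a vector b moves Q from φ onto b. The choice b = 1 kills the Q-term and shows that
the mean unused capacity ∑ c_k p_{0,k} is ε = ∑ p_k (c_k - λ_k h_{k1}). Choosing b with Qb = c - λh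
- ε and subtracting the identity for b = 1 cancels every first-order term and leaves ε (1 - ∑
φ_k(θ)) / θ = ∑ [λ_k r_k(θ) φ_k(θ) - b_k G_k(θ)], where r_k(θ) → h_{k2}/2 and G_k(θ) has an explicit
limit. The right side converges as θ → 0, so finiteness of E W is a conclusion rather than an
assumption, and an exact formula for ε E W results
(`IsSteadyState.integrable_and_integral_workload`).

For the scaled queue ε = c_∞/N, and b = a + a'/N with a' fixed. The only unknowns left are the idle
probabilities. They vanish in a state with positive capacity because ∑ c_k p_{0,k} = c_∞/N, and in
the other states by irreducibility (`tendsto_idle`). Letting N → ∞ in the exact formula gives the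
limit. -/

namespace ModulatedQueue

/-! ### Linear algebra of irreducible generators. -/

section Generator

variable {D : ℕ} {Q : Matrix (Fin D) (Fin D) ℝ}

/-- Harmonic functions of an irreducible generator are constant. -/
theorem IsGenerator.eq_of_mulVec_eq_zero (hQ : IsGenerator Q) (hirr : IsIrreducible Q)
    {a : Fin D → ℝ} (ha : Q.mulVec a = 0) (d l : Fin D) : a d = a l := by
  obtain ⟨m, -, hm⟩ := Finset.exists_max_image Finset.univ a ⟨d, Finset.mem_univ d⟩
  -- Maximum principle: at a maximiser `i`, the equation Qa = 0 is a vanishing sum of nonnegative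
  -- terms, so the maximum spreads along every transition of positive rate.
  have step : ∀ i, a i = a m → ∀ j, i ≠ j ∧ 0 < Q i j → a j = a m := by
    rintro i hi j ⟨hij, hpos⟩
    have h0 : ∑ l, Q i l * (a i - a l) = 0 := by
      have h1 : ∑ l, Q i l * a l = 0 := congrFun ha i
      simp only [mul_sub, Finset.sum_sub_distrib, ← Finset.sum_mul, hQ.row_sum, h1]
      simp
    have hn : ∀ l ∈ Finset.univ, 0 ≤ Q i l * (a i - a l) := by
      intro l _
      by_cases hl : i = l
      · simp [hl]
      · exact mul_nonneg (hQ.off_diag_nonneg i l hl)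
          (sub_nonneg.2 (hi ▸ hm l (Finset.mem_univ l)))
    have := (Finset.sum_eq_zero_iff_of_nonneg hn).1 h0 j (Finset.mem_univ j)
    rcases mul_eq_zero.1 this with h | h
    · exact absurd h hpos.ne'
    · linarith
  have key : ∀ i, a i = a m := by
    intro i
    induction hirr m i with
    | refl => rfl
    | tail _ h ih => exact step _ ih _ h
  rw [key d, key l]

theorem IsInvariant.sum_mul_mulVec {p : Fin D → ℝ} (hp : IsInvariant Q p) (a : Fin D → ℝ) :
    ∑ d, p d * Q.mulVec a d = 0 := by
  have : p ⬝ᵥ Q.mulVec a = 0 := by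
    rw [Matrix.dotProduct_mulVec, hp.balance, zero_dotProduct]
  exact this

/-- The Fredholm alternative for an irreducible generator. -/
theorem IsGenerator.exists_mulVec_eq (hQ : IsGenerator Q) (hirr : IsIrreducible Q)
    {p : Fin D → ℝ} (hp : IsInvariant Q p) {v : Fin D → ℝ} (hv : ∑ d, p d * v d = 0) :
    ∃ a, Q.mulVec a = v := by
  have hD : ∃ d₀ : Fin D, True := by
    by_contra! h
    have := hp.sum_eq_one
    rw [Finset.sum_eq_zero (fun d _ => (h d).elim)] at this
    exact zero_ne_one this
  obtain ⟨d₀, -⟩ := hD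
  let φ : (Fin D → ℝ) →ₗ[ℝ] ℝ := Fintype.linearCombination ℝ p
  have hφ : ∀ w, φ w = ∑ d, p d * w d := fun w => by
    simp [φ, Fintype.linearCombination_apply, mul_comm]
  -- Dimension count: the kernel of Q consists of constants, so the range has dimension at least D -
  -- 1, which is the dimension of the hyperplane p^⊥ containing it.
  have hle : LinearMap.range Q.mulVecLin ≤ LinearMap.ker φ := by
    rintro _ ⟨a, rfl⟩
    rw [LinearMap.mem_ker, hφ]
    exact hp.sum_mul_mulVec a
  have hker : Module.finrank ℝ (LinearMap.ker Q.mulVecLin) ≤ 1 := by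
    refine finrank_le_one ⟨fun _ => 1, ?_⟩ ?_
    · rw [LinearMap.mem_ker]
      ext d
      simpa [Matrix.mulVec, dotProduct] using hQ.row_sum d
    · rintro ⟨a, ha⟩
      refine ⟨a d₀, Subtype.ext (funext fun d => ?_)⟩
      simpa using hQ.eq_of_mulVec_eq_zero hirr (LinearMap.mem_ker.1 ha) d₀ d
  have hsurj : LinearMap.range φ = ⊤ := by
    rw [LinearMap.range_eq_top]
    intro y
    refine ⟨fun _ => y, ?_⟩
    rw [hφ, ← Finset.sum_mul, hp.sum_eq_one, one_mul]
  have e1 := LinearMap.finrank_range_add_finrank_ker Q.mulVecLin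
  have e2 := LinearMap.finrank_range_add_finrank_ker φ
  rw [hsurj, finrank_top, Module.finrank_self] at e2
  have heq := Submodule.eq_of_le_of_finrank_le hle (by omega)
  have : v ∈ LinearMap.range Q.mulVecLin := by
    rw [heq, LinearMap.mem_ker, hφ, hv]
  obtain ⟨a, ha⟩ := this
  exact ⟨a, ha⟩

/-- The invariant distribution of an irreducible generator is unique. -/
theorem IsInvariant.eq_of_balance (hQ : IsGenerator Q) (hirr : IsIrreducible Q)
    {p p' : Fin D → ℝ} (hp : IsInvariant Q p) (hsum : ∑ d, p' d = 1)
    (hbal : ∀ k, ∑ d, p' d * Q d k = 0) : p' = p := by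
  funext k
  -- The k-th unit vector minus the constant p_k is orthogonal to p, hence of the form Qa. Since p'
  -- annihilates the range of Q and has total mass 1, pairing with it gives p'_k = p_k;
  -- nonnegativity of p' plays no role.
  obtain ⟨a, ha⟩ := hQ.exists_mulVec_eq hirr hp (v := fun d => (if d = k then 1 else 0) - p k)
    (by simp [mul_sub, ← Finset.sum_mul, hp.sum_eq_one])
  have h0 : p' ⬝ᵥ Q.mulVec a = 0 := by
    have : Matrix.vecMul p' Q = 0 := funext hbal
    rw [Matrix.dotProduct_mulVec, this, zero_dotProduct]
  rw [ha] at h0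
  have : p' k - p k = 0 := by
    simpa [dotProduct, mul_sub, ← Finset.sum_mul, hsum] using h0
  linarith

end Generator

/-! ### Short-time expansion of the transition operator at exponential test functions. -/

section Bounds

/-- Monotonicity of the lower integral asks for no measurability of `g`. With this bound and its
counterpart below, the iterated integrals in `transitionAux` can be compared with constants without
proving them measurable. -/
theorem lintegral_le_of_ae_le {α : Type*} [MeasurableSpace α] {μ : Measure α}
    [IsProbabilityMeasure μ] {g : α → ℝ≥0∞} {c : ℝ≥0∞} (h : ∀ᵐ x ∂μ, g x ≤ c) :
    ∫⁻ x, g x ∂μ ≤ c :=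
  (lintegral_mono_ae h).trans (by simp)

theorem le_lintegral_of_ae_le {α : Type*} [MeasurableSpace α] {μ : Measure α}
    [IsProbabilityMeasure μ] {g : α → ℝ≥0∞} {c : ℝ≥0∞} (h : ∀ᵐ x ∂μ, c ≤ g x) :
    c ≤ ∫⁻ x, g x ∂μ :=
  le_trans (by simp) (lintegral_mono_ae h)

variable {D : ℕ} {K : Type*} [MeasurableSpace K] {M : Params D K} {S : ServiceDiscipline K}

theorem Params.IsAdmissible.eventRate_nonneg (hM : M.IsAdmissible) (d : Fin D) :
    0 ≤ eventRate M d :=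
  add_nonneg (hM.rate_nonneg d) (Finset.sum_nonneg fun l hl =>
    hM.generator.off_diag_nonneg d l (Finset.ne_of_mem_erase hl).symm)

theorem Params.IsAdmissible.eventRate_eq (hM : M.IsAdmissible) (d : Fin D) :
    eventRate M d = M.rate d - M.gen d d := by
  have := Finset.add_sum_erase Finset.univ (M.gen d) (Finset.mem_univ d)
  rw [hM.generator.row_sum d] at this
  unfold eventRate
  linarith

theorem Params.IsAdmissible.ofReal_eventRate (hM : M.IsAdmissible) (d : Fin D) :
    ENNReal.ofReal (M.rate d) + ∑ l ∈ Finset.univ.erase d, ENNReal.ofReal (M.gen d l)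
      = ENNReal.ofReal (eventRate M d) := by
  have h : ∀ l ∈ Finset.univ.erase d, 0 ≤ M.gen d l := fun l hl =>
    hM.generator.off_diag_nonneg d l (Finset.ne_of_mem_erase hl).symm
  rw [eventRate, ENNReal.ofReal_add (hM.rate_nonneg d) (Finset.sum_nonneg h),
    ENNReal.ofReal_sum_of_nonneg h]

/-- The probability of `n` events in `[0, t]` is at most `(R t) ^ n`. -/
theorem transitionAux_le (hM : M.IsAdmissible) {R : ℝ} (hR : ∀ d, eventRate M d ≤ R)
    {f : S.State × Fin D → ℝ≥0∞} (hf : ∀ q, f q ≤ 1) (n : ℕ) {t : ℝ} (ht : 0 ≤ t)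
    (q : S.State × Fin D) :
    transitionAux M S n t f q ≤ ENNReal.ofReal ((R * t) ^ n) := by
  have hR0 : 0 ≤ R := (hM.eventRate_nonneg q.2).trans (hR q.2)
  have hexp : ∀ d s, 0 ≤ s → ENNReal.ofReal (Real.exp (-(eventRate M d * s))) ≤ 1 := by
    intro d s hs
    rw [ENNReal.ofReal_le_one, Real.exp_le_one_iff, neg_nonpos]
    exact mul_nonneg (hM.eventRate_nonneg d) hs
  induction n generalizing t q with
  | zero =>
    obtain ⟨x, d⟩ := q
    rw [transitionAux, pow_zero, ENNReal.ofReal_one]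
    exact mul_le_one' (hexp d t ht) (lintegral_le_of_ae_le (.of_forall fun y => hf _))
  | succ n ih =>
    obtain ⟨x, d⟩ := q
    rw [transitionAux]
    have := hM.prob d
    -- Replacing t - s by t loses the factor 1/n!, but a geometric bound is enough to make the tail
    -- from n = 2 on of order t².
    calc _ ≤ ∫⁻ s in Set.Icc 0 t, ENNReal.ofReal R * ENNReal.ofReal ((R * t) ^ n) := by
          refine setLIntegral_mono' measurableSet_Icc fun s hs => ?_
          have hb : ∀ q : S.State × Fin D,
              transitionAux M S n (t - s) f q ≤ ENNReal.ofReal ((R * t) ^ n) := fun q => by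
            refine (ih (sub_nonneg.2 hs.2) q).trans (ENNReal.ofReal_le_ofReal ?_)
            have : 0 ≤ t - s := sub_nonneg.2 hs.2
            have := hs.1
            gcongr
            linarith
          refine (mul_le_of_le_one_left' (hexp d s hs.1)).trans ?_
          refine lintegral_le_of_ae_le (.of_forall fun y => ?_)
          calc _ ≤ ENNReal.ofReal (M.rate d) * ENNReal.ofReal ((R * t) ^ n) +
                ∑ l ∈ Finset.univ.erase d,
                  ENNReal.ofReal (M.gen d l) * ENNReal.ofReal ((R * t) ^ n) := by
                gcongr
                · exact lintegral_le_of_ae_le (.of_forall fun z =>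
                    lintegral_le_of_ae_le (.of_forall fun y' => hb _))
                · exact hb _
            _ = ENNReal.ofReal (eventRate M d) * ENNReal.ofReal ((R * t) ^ n) := by
                rw [← Finset.sum_mul, ← add_mul, hM.ofReal_eventRate]
            _ ≤ _ := by gcongr; exact hR d
      _ = ENNReal.ofReal ((R * t) ^ (n + 1)) := by
          rw [setLIntegral_const, Real.volume_Icc, sub_zero, ← ENNReal.ofReal_mul hR0,
            ← ENNReal.ofReal_mul (by positivity)]
          congr 1
          ring

theorem tsum_eq_add_add_tsum (u : ℕ → ℝ≥0∞) : ∑' n, u n = u 0 + u 1 + ∑' n, u (n + 2) := by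
  rw [← Summable.sum_add_tsum_nat_add' (f := u) (k := 2) ENNReal.summable,
    Finset.sum_range_succ, Finset.sum_range_one]

/-- At most two events matter over short times. -/
theorem transition_le (hM : M.IsAdmissible) {R : ℝ} (hR : ∀ d, eventRate M d ≤ R)
    {f : S.State × Fin D → ℝ≥0∞} (hf : ∀ q, f q ≤ 1) {t : ℝ} (ht : 0 ≤ t) (hRt : R * t ≤ 1 / 2)
    (q : S.State × Fin D) :
    transition M S t f q ≤ transitionAux M S 0 t f q + transitionAux M S 1 t f q
      + ENNReal.ofReal (2 * (R * t) ^ 2) := by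
  have hR0 : 0 ≤ R * t := mul_nonneg ((hM.eventRate_nonneg q.2).trans (hR q.2)) ht
  refine (tsum_eq_add_add_tsum fun n => transitionAux M S n t f q).le.trans
    (add_le_add le_rfl ?_)
  calc ∑' n, transitionAux M S (n + 2) t f q
      ≤ ∑' n : ℕ, ENNReal.ofReal ((R * t) ^ 2 * (1 / 2) ^ n) := by
        refine ENNReal.tsum_le_tsum fun n => (transitionAux_le hM hR hf _ ht q).trans ?_
        refine ENNReal.ofReal_le_ofReal ?_
        rw [pow_add, mul_comm]
        gcongr
    _ = ENNReal.ofReal (2 * (R * t) ^ 2) := by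
        rw [← ENNReal.ofReal_tsum_of_nonneg (fun n => by positivity)
          (summable_geometric_two.mul_left _), tsum_mul_left, tsum_geometric_two, mul_comm]

theorem le_transition {f : S.State × Fin D → ℝ≥0∞} {t : ℝ} (q : S.State × Fin D) :
    transitionAux M S 0 t f q + transitionAux M S 1 t f q ≤ transition M S t f q :=
  le_self_add.trans (tsum_eq_add_add_tsum fun n => transitionAux M S n t f q).ge

/-- The Laplace transform of the service requirement. -/
noncomputable def Params.serviceLaplace (M : Params D K) (θ : ℝ) (d : Fin D) : ℝ :=
  ∫ z, Real.exp (-(θ * z.2)) ∂(M.customerLaw d)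

/-- The exponential test function of workload and environment that lives on the state `k`. -/
noncomputable def expTest (θ : ℝ) (k : Fin D) (r : ℝ≥0 × Fin D) : ℝ :=
  if r.2 = k then Real.exp (-(θ * r.1)) else 0

theorem expTest_nonneg (θ : ℝ) (k : Fin D) (r : ℝ≥0 × Fin D) : 0 ≤ expTest θ k r := by
  unfold expTest; split_ifs <;> positivity

theorem expTest_le_one {θ : ℝ} (hθ : 0 ≤ θ) (k : Fin D) (r : ℝ≥0 × Fin D) :
    expTest θ k r ≤ 1 := by
  unfold expTest
  split_ifs
  · rw [Real.exp_le_one_iff, neg_nonpos]; positivity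
  · exact zero_le_one

theorem measurable_expTest (θ : ℝ) (k : Fin D) : Measurable (expTest θ k) := by
  unfold expTest
  refine Measurable.ite (measurable_snd (measurableSet_singleton k)) ?_ measurable_const
  fun_prop

theorem expTest_antitone {θ : ℝ} (hθ : 0 ≤ θ) (k d : Fin D) {w w' : ℝ≥0} (h : w ≤ w') :
    expTest θ k (w', d) ≤ expTest θ k (w, d) := by
  unfold expTest
  dsimp only
  split_ifs
  · gcongr
  · rfl

theorem expTest_add (θ : ℝ) (k d : Fin D) (z w : ℝ≥0) :
    expTest θ k (z + w, d) = Real.exp (-(θ * z)) * expTest θ k (w, d) := by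
  unfold expTest
  dsimp only
  split_ifs
  · rw [← Real.exp_add]; congr 1; push_cast; ring
  · simp

/-- Truncation at zero only shrinks the effect of service, since w ≤ b + (w - b). The idle boundary
therefore needs no separate case in the error bounds. -/
theorem expTest_sub_le {θ : ℝ} (hθ : 0 ≤ θ) (k d : Fin D) (w b : ℝ≥0) :
    expTest θ k (w - b, d) ≤ Real.exp (θ * b) * expTest θ k (w, d) := by
  have h : expTest θ k (b + (w - b), d) ≤ expTest θ k (w, d) :=
    expTest_antitone hθ k d le_add_tsub
  rw [expTest_add] at h
  calc _ = Real.exp (θ * b) * (Real.exp (-(θ * b)) * expTest θ k (w - b, d)) := by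
        rw [← mul_assoc, ← Real.exp_add]; simp
    _ ≤ _ := by gcongr

/-- The contribution of arrivals and environment jumps to the generator at `expTest`. -/
noncomputable def jumpPart (M : Params D K) (θ : ℝ) (k : Fin D) (r : ℝ≥0 × Fin D) : ℝ :=
  M.rate r.2 * (M.serviceLaplace θ r.2 * expTest θ k r) +
    ∑ l ∈ Finset.univ.erase r.2, M.gen r.2 l * expTest θ k (r.1, l)

theorem Params.serviceLaplace_nonneg (M : Params D K) (θ : ℝ) (d : Fin D) :
    0 ≤ M.serviceLaplace θ d := integral_nonneg fun _ => (Real.exp_pos _).le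

theorem jumpPart_nonneg (hM : M.IsAdmissible) (θ : ℝ) (k : Fin D) (r : ℝ≥0 × Fin D) :
    0 ≤ jumpPart M θ k r :=
  add_nonneg (mul_nonneg (hM.rate_nonneg _)
      (mul_nonneg (M.serviceLaplace_nonneg _ _) (expTest_nonneg _ _ _)))
    (Finset.sum_nonneg fun l hl => mul_nonneg
      (hM.generator.off_diag_nonneg _ l (Finset.ne_of_mem_erase hl).symm) (expTest_nonneg _ _ _))

theorem integrable_exp_neg (hM : M.IsAdmissible) {θ : ℝ} (hθ : 0 ≤ θ) (d : Fin D) :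
    Integrable (fun z : K × ℝ≥0 => Real.exp (-(θ * z.2))) (M.customerLaw d) := by
  have := hM.prob d
  refine Integrable.of_bound (C := 1) (by fun_prop) (.of_forall fun z => ?_)
  rw [Real.norm_of_nonneg (Real.exp_pos _).le, Real.exp_le_one_iff, neg_nonpos]
  positivity

theorem ofReal_serviceLaplace (hM : M.IsAdmissible) {θ : ℝ} (hθ : 0 ≤ θ) (d : Fin D) :
    ENNReal.ofReal (M.serviceLaplace θ d) =
      ∫⁻ z, ENNReal.ofReal (Real.exp (-(θ * z.2))) ∂(M.customerLaw d) :=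
  ofReal_integral_eq_lintegral_ofReal (integrable_exp_neg hM hθ d)
    (.of_forall fun _ => (Real.exp_pos _).le)

/-- Puts `jumpPart` into the shape of the one-event integrand of `transitionAux`. The factor `c`
makes room for the exponential errors of the upper and the lower bound. -/
theorem ofReal_jumpPart (hM : M.IsAdmissible) {θ : ℝ} (hθ : 0 ≤ θ) (k : Fin D) (w : ℝ≥0)
    (d : Fin D) {c : ℝ} (hc : 0 ≤ c) :
    ENNReal.ofReal (c * jumpPart M θ k (w, d)) =
      ENNReal.ofReal (M.rate d) * ∫⁻ z, ENNReal.ofReal (c * expTest θ k (z.2 + w, d))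
          ∂(M.customerLaw d) +
        ∑ l ∈ Finset.univ.erase d,
          ENNReal.ofReal (M.gen d l) * ENNReal.ofReal (c * expTest θ k (w, l)) := by
  have hn : ∀ l ∈ Finset.univ.erase d, 0 ≤ M.gen d l * (c * expTest θ k (w, l)) := fun l hl =>
    mul_nonneg (hM.generator.off_diag_nonneg d l (Finset.ne_of_mem_erase hl).symm)
      (mul_nonneg hc (expTest_nonneg _ _ _))
  have e : c * jumpPart M θ k (w, d) =
      M.rate d * (M.serviceLaplace θ d * (c * expTest θ k (w, d))) +
        ∑ l ∈ Finset.univ.erase d, M.gen d l * (c * expTest θ k (w, l)) := by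
    simp only [jumpPart, mul_add, Finset.mul_sum]
    congr 1
    · ring
    · exact Finset.sum_congr rfl fun _ _ => by ring
  have hr := hM.rate_nonneg d
  have hl := M.serviceLaplace_nonneg θ d
  have hx := expTest_nonneg θ k (w, d)
  rw [e, ENNReal.ofReal_add (by positivity) (Finset.sum_nonneg hn),
    ENNReal.ofReal_sum_of_nonneg hn, ENNReal.ofReal_mul hr, ENNReal.ofReal_mul hl,
    ofReal_serviceLaplace hM hθ, ← lintegral_mul_const _ (by fun_prop)]
  congr 1
  · congr 1
    refine lintegral_congr fun z => ?_
    rw [← ENNReal.ofReal_mul (Real.exp_pos _).le, expTest_add]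
    congr 1
    ring
  · refine Finset.sum_congr rfl fun l hl => ?_
    rw [ENNReal.ofReal_mul
      (hM.generator.off_diag_nonneg d l (Finset.ne_of_mem_erase hl).symm)]

/-- The expectation of `expTest` on the event that nothing happens. -/
theorem transitionAux_zero_expTest (θ : ℝ) (k : Fin D) (t : ℝ) (x : S.State) (d : Fin D) :
    transitionAux M S 0 t (fun r => ENNReal.ofReal (expTest θ k (S.workload r.1, r.2))) (x, d) =
      ENNReal.ofReal (Real.exp (-(eventRate M d * t)) *
        expTest θ k (S.workload x - (M.cap d * t).toNNReal, d)) := by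
  rw [transitionAux, ENNReal.ofReal_mul (Real.exp_pos _).le]
  congr 1
  rw [lintegral_congr_ae (g := fun _ =>
    ENNReal.ofReal (expTest θ k (S.workload x - (M.cap d * t).toNNReal, d)))]
  · simp
  · filter_upwards [S.serve_residual (M.cap d * t).toNNReal x] with y hy
    simp only [ServiceDiscipline.workload, hy]

variable {R C : ℝ}

theorem transitionAux_zero_le (hM : M.IsAdmissible) {θ : ℝ} (hθ : 0 ≤ θ)
    (hC : ∀ d, M.cap d ≤ C) (k : Fin D) {t : ℝ} (ht : 0 ≤ t) (q : S.State × Fin D) :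
    transitionAux M S 0 t (fun r => ENNReal.ofReal (expTest θ k (S.workload r.1, r.2))) q ≤
      ENNReal.ofReal (Real.exp (θ * (C * t)) * expTest θ k (S.workload q.1, q.2)) := by
  obtain ⟨x, d⟩ := q
  rw [transitionAux_zero_expTest]
  refine ENNReal.ofReal_le_ofReal ?_
  have h1 : Real.exp (-(eventRate M d * t)) ≤ 1 := by
    rw [Real.exp_le_one_iff, neg_nonpos]
    exact mul_nonneg (hM.eventRate_nonneg d) ht
  refine (mul_le_of_le_one_left (expTest_nonneg _ _ _) h1).trans
    ((expTest_sub_le hθ _ _ _ _).trans ?_)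
  refine mul_le_mul_of_nonneg_right (Real.exp_le_exp.2 ?_) (expTest_nonneg _ _ _)
  rw [Real.coe_toNNReal _ (mul_nonneg (hM.cap_nonneg d) ht)]
  have := hC d
  gcongr

theorem le_transitionAux_zero (hR : ∀ d, eventRate M d ≤ R) {θ : ℝ} (hθ : 0 ≤ θ)
    (k : Fin D) {t : ℝ} (ht : 0 ≤ t) (q : S.State × Fin D) :
    ENNReal.ofReal (Real.exp (-(R * t)) * expTest θ k (S.workload q.1, q.2)) ≤
    transitionAux M S 0 t (fun r => ENNReal.ofReal (expTest θ k (S.workload r.1, r.2))) q := by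
  obtain ⟨x, d⟩ := q
  rw [transitionAux_zero_expTest]
  refine ENNReal.ofReal_le_ofReal ?_
  have := hR d
  refine mul_le_mul ?_ (expTest_antitone hθ k d tsub_le_self) (expTest_nonneg _ _ _)
    (Real.exp_pos _).le
  gcongr

/-- At most C t of work is served in total before and after the single event, so ignoring service
costs at most a factor exp(θCt). A two-sided estimate up to factors 1 + O(t) suffices because the
one-event term is itself O(t). -/
theorem transitionAux_one_le (hM : M.IsAdmissible) {θ : ℝ} (hθ : 0 ≤ θ)
    (hC : ∀ d, M.cap d ≤ C) (k : Fin D) {t : ℝ} (q : S.State × Fin D) :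
    transitionAux M S 1 t (fun r => ENNReal.ofReal (expTest θ k (S.workload r.1, r.2))) q ≤
      ENNReal.ofReal (t * (Real.exp (θ * (C * t)) *
        jumpPart M θ k (S.workload q.1, q.2))) := by
  obtain ⟨x, d⟩ := q
  have hJ := jumpPart_nonneg hM θ k (S.workload x, d)
  have := hM.prob d
  rw [transitionAux]
  calc _ ≤ ∫⁻ s in Set.Icc 0 t,
        ENNReal.ofReal (Real.exp (θ * (C * t)) * jumpPart M θ k (S.workload x, d)) := by
        refine setLIntegral_mono' measurableSet_Icc fun s hs => ?_
        have h1 : ENNReal.ofReal (Real.exp (-(eventRate M d * s))) ≤ 1 := by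
          rw [ENNReal.ofReal_le_one, Real.exp_le_one_iff, neg_nonpos]
          exact mul_nonneg (hM.eventRate_nonneg d) hs.1
        refine (mul_le_of_le_one_left' h1).trans ?_
        refine lintegral_le_of_ae_le ?_
        filter_upwards [S.serve_residual (M.cap d * s).toNNReal x] with y hy
        rw [ofReal_jumpPart hM hθ k _ d (Real.exp_pos _).le]
        -- Here `w` is the workload that the event would produce without any service before it; the
        -- factors for service on [0, s] and on [s, t] combine into exp(θCt).
        have key : ∀ (w : ℝ≥0) (l : Fin D) (y' : S.State),
            w - (M.cap d * s).toNNReal ≤ S.workload y' →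
            transitionAux M S 0 (t - s)
              (fun r => ENNReal.ofReal (expTest θ k (S.workload r.1, r.2))) (y', l) ≤
            ENNReal.ofReal (Real.exp (θ * (C * t)) * expTest θ k (w, l)) := by
          intro w l y' hy'
          refine (transitionAux_zero_le hM hθ hC k (sub_nonneg.2 hs.2) _).trans
            (ENNReal.ofReal_le_ofReal ?_)
          have h2 := (expTest_antitone hθ k l hy').trans (expTest_sub_le hθ k l w _)
          rw [Real.coe_toNNReal _ (mul_nonneg (hM.cap_nonneg d) hs.1)] at h2
          calc _ ≤ Real.exp (θ * (C * (t - s))) *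
                (Real.exp (θ * (M.cap d * s)) * expTest θ k (w, l)) := by gcongr
            _ = Real.exp (θ * (C * (t - s)) + θ * (M.cap d * s)) * expTest θ k (w, l) := by
                rw [Real.exp_add, mul_assoc]
            _ ≤ _ := by
                refine mul_le_mul_of_nonneg_right (Real.exp_le_exp.2 ?_) (expTest_nonneg _ _ _)
                have := mul_le_mul_of_nonneg_left
                  (mul_le_mul_of_nonneg_right (hC d) hs.1) hθ
                linarith
        gcongr with z l
        · refine lintegral_le_of_ae_le ?_
          filter_upwards [S.join_residual y z] with y' hy'
          refine key _ _ _ ?_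
          rw [show S.workload y' = (S.residual y').sum from rfl, hy', Multiset.sum_cons, hy]
          exact add_tsub_le_assoc
        · exact key _ _ _ hy.ge
    _ = _ := by
        rw [setLIntegral_const, Real.volume_Icc, sub_zero, ← ENNReal.ofReal_mul (by positivity)]
        congr 1
        ring

theorem le_transitionAux_one (hM : M.IsAdmissible) {θ : ℝ} (hθ : 0 ≤ θ)
    (hR : ∀ d, eventRate M d ≤ R) (k : Fin D) {t : ℝ} (q : S.State × Fin D) :
    ENNReal.ofReal (t * (Real.exp (-(R * t)) * jumpPart M θ k (S.workload q.1, q.2))) ≤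
    transitionAux M S 1 t (fun r => ENNReal.ofReal (expTest θ k (S.workload r.1, r.2))) q := by
  obtain ⟨x, d⟩ := q
  have hJ := jumpPart_nonneg hM θ k (S.workload x, d)
  have := hM.prob d
  rw [transitionAux]
  calc _ = ∫⁻ s in Set.Icc 0 t,
        ENNReal.ofReal (Real.exp (-(R * t)) * jumpPart M θ k (S.workload x, d)) := by
        rw [setLIntegral_const, Real.volume_Icc, sub_zero, ← ENNReal.ofReal_mul (by positivity)]
        congr 1
        ring
    _ ≤ _ := by
        refine setLIntegral_mono' measurableSet_Icc fun s hs => ?_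
        -- The factor exp(-Rt) is shared between no event before `s` and none after it. Service is
        -- dropped altogether, as it only increases the test function.
        have h1 : Real.exp (-(R * t)) * jumpPart M θ k (S.workload x, d) ≤
            Real.exp (-(eventRate M d * s)) *
              (Real.exp (-(R * (t - s))) * jumpPart M θ k (S.workload x, d)) := by
          rw [← mul_assoc, ← Real.exp_add]
          refine mul_le_mul_of_nonneg_right (Real.exp_le_exp.2 ?_) hJ
          have := mul_le_mul_of_nonneg_right (hR d) hs.1
          linarith
        refine (ENNReal.ofReal_le_ofReal h1).trans ?_
        rw [ENNReal.ofReal_mul (Real.exp_pos _).le]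
        gcongr
        refine le_lintegral_of_ae_le ?_
        filter_upwards [S.serve_residual (M.cap d * s).toNNReal x] with y hy
        rw [ofReal_jumpPart hM hθ k _ d (Real.exp_pos _).le]
        have key : ∀ (w : ℝ≥0) (l : Fin D) (y' : S.State), S.workload y' ≤ w →
            ENNReal.ofReal (Real.exp (-(R * (t - s))) * expTest θ k (w, l)) ≤
            transitionAux M S 0 (t - s)
              (fun r => ENNReal.ofReal (expTest θ k (S.workload r.1, r.2))) (y', l) := by
          intro w l y' hy'
          refine le_trans (ENNReal.ofReal_le_ofReal ?_)
            (le_transitionAux_zero hR hθ k (sub_nonneg.2 hs.2) _)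
          exact mul_le_mul_of_nonneg_left (expTest_antitone hθ k l hy') (Real.exp_pos _).le
        gcongr with z l
        · refine le_lintegral_of_ae_le ?_
          filter_upwards [S.join_residual y z] with y' hy'
          refine key _ _ _ ?_
          rw [ServiceDiscipline.workload, hy', Multiset.sum_cons, hy]
          gcongr
          exact tsub_le_self
        · exact key _ _ _ (hy.le.trans tsub_le_self)

end Bounds

/-! ### The balance equation for the Laplace transforms in steady state. -/

section Balance

variable {D : ℕ} {K : Type*} [MeasurableSpace K] {M : Params D K} {S : ServiceDiscipline K}

/-- Passes from jumps out of the current state to jumps into the target `k`. In this form the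
integral of `jumpPart` is a linear combination of the transforms φ_l. -/
theorem jumpPart_eq (M : Params D K) (θ : ℝ) (k : Fin D) (r : ℝ≥0 × Fin D) :
    jumpPart M θ k r = M.rate k * M.serviceLaplace θ k * expTest θ k r +
      ∑ l ∈ Finset.univ.erase k, M.gen l k * expTest θ l r := by
  obtain ⟨w, d⟩ := r
  unfold jumpPart expTest
  dsimp only
  by_cases h : d = k
  · subst h
    simp only [if_true, mul_ite, mul_zero, Finset.sum_ite_eq, Finset.sum_ite_eq',
      Finset.mem_erase, ne_eq, not_true_eq_false, false_and, if_false]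
    ring
  · simp [h, Ne.symm h]

/-- The contribution of the event that nothing happens to the transition operator. -/
noncomputable def quietPart (M : Params D K) (θ : ℝ) (k : Fin D) (t : ℝ) (r : ℝ≥0 × Fin D) : ℝ :=
  Real.exp (-(eventRate M r.2 * t)) * expTest θ k (r.1 - (M.cap r.2 * t).toNNReal, r.2)

/-- The indicator function of an idle server in the environment state `k`. -/
noncomputable def idle (k : Fin D) (r : ℝ≥0 × Fin D) : ℝ := if r.1 = 0 ∧ r.2 = k then 1 else 0

theorem quietPart_nonneg (θ : ℝ) (k : Fin D) (t : ℝ) (r : ℝ≥0 × Fin D) :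
    0 ≤ quietPart M θ k t r := mul_nonneg (Real.exp_pos _).le (expTest_nonneg _ _ _)

theorem measurable_quietPart (θ : ℝ) (k : Fin D) (t : ℝ) : Measurable (quietPart M θ k t) := by
  have h : ∀ g : Fin D → ℝ, Measurable fun r : ℝ≥0 × Fin D => g r.2 := fun g =>
    (measurable_of_finite g).comp measurable_snd
  have h1 : Measurable fun r : ℝ≥0 × Fin D => (M.cap r.2 * t).toNNReal :=
    measurable_real_toNNReal.comp (h fun d => M.cap d * t)
  exact (h fun d => Real.exp (-(eventRate M d * t))).mul
    ((measurable_expTest θ k).comp ((measurable_fst.sub h1).prodMk measurable_snd))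

theorem measurable_idle (k : Fin D) : Measurable (idle k) :=
  Measurable.ite ((measurable_fst (measurableSet_singleton 0)).inter
    (measurable_snd (measurableSet_singleton k))) measurable_const measurable_const

theorem idle_nonneg (k : Fin D) (r : ℝ≥0 × Fin D) : 0 ≤ idle k r := by
  unfold idle; split_ifs <;> simp

theorem idle_le_expTest (θ : ℝ) (k : Fin D) (r : ℝ≥0 × Fin D) : idle k r ≤ expTest θ k r := by
  unfold idle
  split_ifs with h
  · simp [expTest, h.1, h.2]
  · exact expTest_nonneg _ _ _

theorem idle_le_one (k : Fin D) (r : ℝ≥0 × Fin D) : idle k r ≤ 1 := by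
  unfold idle; split_ifs <;> simp

theorem quietPart_le_one (hM : M.IsAdmissible) {θ : ℝ} (hθ : 0 ≤ θ) (k : Fin D) {t : ℝ}
    (ht : 0 ≤ t) (r : ℝ≥0 × Fin D) : quietPart M θ k t r ≤ 1 := by
  refine mul_le_one₀ ?_ (expTest_nonneg _ _ _) (expTest_le_one hθ _ _)
  rw [Real.exp_le_one_iff, neg_nonpos]
  exact mul_nonneg (hM.eventRate_nonneg _) ht

theorem quietPart_of_ne {θ : ℝ} {k : Fin D} {t : ℝ} {r : ℝ≥0 × Fin D} (h : r.2 ≠ k) :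
    quietPart M θ k t r = 0 := by
  simp [quietPart, expTest, h]

/-- The bound is linear in t and uniform in the workload, so it dominates the difference quotients
when the derivative at t = 0 is taken under the integral. -/
theorem abs_quietPart_sub_le (hM : M.IsAdmissible) {θ : ℝ} (hθ : 0 ≤ θ) (k : Fin D) {t : ℝ}
    (ht : 0 ≤ t) (r : ℝ≥0 × Fin D) :
    |quietPart M θ k t r - expTest θ k r| ≤ (eventRate M k + θ * M.cap k) * t := by
  have hr := hM.eventRate_nonneg k
  have hc := hM.cap_nonneg k
  by_cases h : r.2 = k
  · obtain ⟨w, d⟩ := r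
    obtain rfl : d = k := h
    set b := (M.cap d * t).toNNReal with hb
    have hbt : (b : ℝ) = M.cap d * t := Real.coe_toNNReal _ (mul_nonneg hc ht)
    have h1 : Real.exp (-(θ * b)) * expTest θ d (w - b, d) ≤ expTest θ d (w, d) := by
      rw [← expTest_add]
      exact expTest_antitone hθ d d le_add_tsub
    have h2 : expTest θ d (w, d) ≤ expTest θ d (w - b, d) :=
      expTest_antitone hθ d d tsub_le_self
    have h3 := expTest_le_one hθ d (w - b, d)
    have h0 := expTest_nonneg θ d (w - b, d)
    have e1 := Real.one_sub_le_exp_neg (θ * b)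
    have e2 := Real.one_sub_le_exp_neg (eventRate M d * t)
    have e3 : Real.exp (-(eventRate M d * t)) ≤ 1 := by
      rw [Real.exp_le_one_iff, neg_nonpos]; positivity
    have hrt : 0 ≤ eventRate M d * t := by positivity
    have hθb : 0 ≤ θ * b := by positivity
    rw [show (eventRate M d + θ * M.cap d) * t = eventRate M d * t + θ * b by rw [hbt]; ring]
    change |Real.exp (-(eventRate M d * t)) * expTest θ d (w - b, d) - _| ≤ _
    rw [abs_le]
    constructor
    · nlinarith
    · nlinarith
  · rw [quietPart_of_ne h]
    have : expTest θ k r = 0 := by simp [expTest, h]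
    rw [this, sub_zero, abs_zero]
    positivity

/-- A positive workload is not exhausted for small t and drifts down at rate c_k; an empty queue
stays empty. The term with `idle` removes the drift in the second case, and is how the idle
probabilities enter the balance equation. -/
theorem tendsto_quietPart (hM : M.IsAdmissible) (θ : ℝ) (k : Fin D) (r : ℝ≥0 × Fin D) :
    Tendsto (fun t => t⁻¹ * (quietPart M θ k t r - expTest θ k r)) (𝓝[>] 0)
      (𝓝 (-eventRate M k * expTest θ k r
        + M.cap k * θ * (expTest θ k r - idle k r))) := by
  have hc := hM.cap_nonneg k
  by_cases h : r.2 = k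
  · obtain ⟨w, d⟩ := r
    obtain rfl : d = k := h
    rcases eq_or_ne w 0 with rfl | hw
    · have hd : HasDerivAt (fun t => Real.exp (-(eventRate M d * t))) (-eventRate M d) 0 := by
        have := (((hasDerivAt_id (0 : ℝ)).const_mul (eventRate M d)).neg).exp
        simpa using this
      simpa [quietPart, expTest, idle] using hd.tendsto_slope_zero_right
    · have hw0 : (0 : ℝ) < w := NNReal.coe_pos.2 (pos_iff_ne_zero.2 hw)
      have hd : HasDerivAt (fun t => Real.exp (-(eventRate M d * t) + -(θ * (w - M.cap d * t))))
          ((-eventRate M d + M.cap d * θ) * Real.exp (-(θ * w))) 0 := by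
        have h1 : HasDerivAt (fun t => -(eventRate M d * t) + -(θ * (w - M.cap d * t)))
            (-eventRate M d + M.cap d * θ) 0 := by
          have h2 := ((hasDerivAt_id' (0 : ℝ)).const_mul (M.cap d * θ - eventRate M d)).add_const
            (-(θ * w))
          refine (h2.congr_deriv (by ring)).congr_of_eventuallyEq (.of_forall fun t => ?_)
          ring
        exact h1.exp.congr_deriv (by simp [mul_comm])
      have hlim := hd.tendsto_slope_zero_right
      have hev : ∀ᶠ t in 𝓝[>] (0 : ℝ), M.cap d * t < w := by
        have : Tendsto (fun t => M.cap d * t) (𝓝 (0 : ℝ)) (𝓝 0) := by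
          simpa using (continuous_const_mul (M.cap d)).tendsto (0 : ℝ)
        exact (this.eventually_lt_const hw0).filter_mono nhdsWithin_le_nhds
      have e : -eventRate M d * expTest θ d (w, d)
          + M.cap d * θ * (expTest θ d (w, d) - idle d (w, d))
          = (-eventRate M d + M.cap d * θ) * Real.exp (-(θ * w)) := by
        simp [expTest, idle, hw]; ring
      rw [e]
      refine hlim.congr' ?_
      filter_upwards [hev, self_mem_nhdsWithin] with t ht ht0
      have hle : (M.cap d * t).toNNReal ≤ w := Real.toNNReal_le_iff_le_coe.2 ht.le
      have hcoe : ((w - (M.cap d * t).toNNReal : ℝ≥0) : ℝ) = w - M.cap d * t := by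
        rw [NNReal.coe_sub hle, Real.coe_toNNReal _ (mul_nonneg hc (le_of_lt ht0))]
      simp [quietPart, expTest, hcoe, Real.exp_add]
  · have h1 : expTest θ k r = 0 := by simp [expTest, h]
    have h2 : idle k r = 0 := by simp [idle, h]
    simp [quietPart_of_ne h, h1, h2]

/-- The Laplace transform of the workload on the event that the environment is in state `k`. -/
noncomputable def workloadLaplace (S : ServiceDiscipline K) (μ : Measure (S.State × Fin D))
    (θ : ℝ) (k : Fin D) : ℝ :=
  ∫ q, expTest θ k (S.workload q.1, q.2) ∂μ

theorem ServiceDiscipline.measurable_workload (S : ServiceDiscipline K) :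
    Measurable S.workload := S.measurable_residual_sum

theorem measurable_workload_prodMk :
    Measurable fun q : S.State × Fin D => (S.workload q.1, q.2) :=
  (S.measurable_workload.comp measurable_fst).prodMk measurable_snd

variable {μ : Measure (S.State × Fin D)}

theorem integrable_comp_workload [IsProbabilityMeasure μ] {g : ℝ≥0 × Fin D → ℝ}
    (hg : Measurable g) (h0 : ∀ r, 0 ≤ g r) (h1 : ∀ r, g r ≤ 1) :
    Integrable (fun q => g (S.workload q.1, q.2)) μ := by
  refine Integrable.of_bound (C := 1)
    (hg.comp measurable_workload_prodMk).aestronglyMeasurable (.of_forall fun q => ?_)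
  rw [Real.norm_of_nonneg (h0 _)]
  exact h1 _

theorem integrable_expTest [IsProbabilityMeasure μ] {θ : ℝ} (hθ : 0 ≤ θ) (k : Fin D) :
    Integrable (fun q => expTest θ k (S.workload q.1, q.2)) μ :=
  integrable_comp_workload (measurable_expTest θ k) (expTest_nonneg θ k) (expTest_le_one hθ k)

theorem integrable_jumpPart [IsProbabilityMeasure μ] {θ : ℝ} (hθ : 0 ≤ θ) (k : Fin D) :
    Integrable (fun q => jumpPart M θ k (S.workload q.1, q.2)) μ := by
  simp only [jumpPart_eq]
  exact ((integrable_expTest hθ k).const_mul _).add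
    (integrable_finsetSum _ fun l _ => (integrable_expTest hθ l).const_mul _)

theorem integral_jumpPart [IsProbabilityMeasure μ] {θ : ℝ} (hθ : 0 ≤ θ) (k : Fin D) :
    ∫ q, jumpPart M θ k (S.workload q.1, q.2) ∂μ =
      M.rate k * M.serviceLaplace θ k * workloadLaplace S μ θ k +
      ∑ l ∈ Finset.univ.erase k, M.gen l k * workloadLaplace S μ θ l := by
  simp only [jumpPart_eq]
  rw [integral_add ((integrable_expTest hθ k).const_mul _)
    (integrable_finsetSum _ fun l _ => (integrable_expTest hθ l).const_mul _),
    integral_finsetSum _ fun l _ => (integrable_expTest hθ l).const_mul _, integral_const_mul]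
  simp only [integral_const_mul, workloadLaplace]

theorem integrable_idle [IsProbabilityMeasure μ] (k : Fin D) :
    Integrable (fun q => idle k (S.workload q.1, q.2)) μ :=
  integrable_comp_workload (measurable_idle k) (idle_nonneg k) (idle_le_one k)

theorem integral_idle (k : Fin D) :
    ∫ q, idle k (S.workload q.1, q.2) ∂μ = μ.real {q | S.workload q.1 = 0 ∧ q.2 = k} := by
  have hm : MeasurableSet {q : S.State × Fin D | S.workload q.1 = 0 ∧ q.2 = k} :=
    measurable_workload_prodMk ((measurable_fst (measurableSet_singleton 0)).inter
      (measurable_snd (measurableSet_singleton k)))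
  rw [← integral_indicator_one hm]
  refine integral_congr_ae (.of_forall fun q => ?_)
  simp [idle, Set.indicator_apply]

theorem integrable_quietPart [IsProbabilityMeasure μ] (hM : M.IsAdmissible) {θ : ℝ} (hθ : 0 ≤ θ)
    (k : Fin D) {t : ℝ} (ht : 0 ≤ t) :
    Integrable (fun q => quietPart M θ k t (S.workload q.1, q.2)) μ :=
  integrable_comp_workload (measurable_quietPart θ k t) (quietPart_nonneg θ k t)
    (quietPart_le_one hM hθ k ht)

theorem IsSteadyState.lintegral_transition (h : IsSteadyState M S μ) (θ : ℝ) (k : Fin D)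
    {t : ℝ} (ht : 0 ≤ t) :
    ∫⁻ q, transition M S t (fun r => ENNReal.ofReal (expTest θ k (S.workload r.1, r.2))) q ∂μ
      = ∫⁻ q, ENNReal.ofReal (expTest θ k (S.workload q.1, q.2)) ∂μ :=
  h.stationary t ht (fun r => ENNReal.ofReal (expTest θ k r))
    (measurable_expTest θ k).ennreal_ofReal

variable {R C : ℝ}

/-- Stationarity replaces the transform by the integral of the transition operator, of which only
the terms with zero and one event are kept. The operator is compared pointwise with measurable
functions, so its own measurability is not needed; the same holds for the reverse bound. -/
theorem IsSteadyState.integral_quietPart_add_le (h : IsSteadyState M S μ) (hM : M.IsAdmissible)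
    {θ : ℝ} (hθ : 0 ≤ θ) (hR : ∀ d, eventRate M d ≤ R) (k : Fin D) {t : ℝ} (ht : 0 ≤ t) :
    (∫ q, quietPart M θ k t (S.workload q.1, q.2) ∂μ) +
      t * (Real.exp (-(R * t)) * ∫ q, jumpPart M θ k (S.workload q.1, q.2) ∂μ) ≤
    workloadLaplace S μ θ k := by
  have := h.prob
  have i1 := integrable_quietPart (μ := μ) hM hθ k ht
  have i2 := ((integrable_jumpPart (μ := μ) (M := M) hθ k).const_mul
    (Real.exp (-(R * t)))).const_mul t
  have i12 : Integrable (fun q => quietPart M θ k t (S.workload q.1, q.2) +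
      t * (Real.exp (-(R * t)) * jumpPart M θ k (S.workload q.1, q.2))) μ := i1.add i2
  have n2 : ∀ q : S.State × Fin D,
      0 ≤ t * (Real.exp (-(R * t)) * jumpPart M θ k (S.workload q.1, q.2)) := fun q =>
    mul_nonneg ht (mul_nonneg (Real.exp_pos _).le (jumpPart_nonneg hM _ _ _))
  rw [← integral_const_mul, ← integral_const_mul, ← integral_add i1 i2, workloadLaplace,
    ← ENNReal.ofReal_le_ofReal_iff (integral_nonneg fun _ => expTest_nonneg _ _ _),
    ofReal_integral_eq_lintegral_ofReal i12
      (.of_forall fun q => add_nonneg (quietPart_nonneg _ _ _ _) (n2 q)),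
    ofReal_integral_eq_lintegral_ofReal (integrable_expTest hθ k)
      (.of_forall fun _ => expTest_nonneg _ _ _),
    ← h.lintegral_transition θ k ht]
  refine lintegral_mono fun q => le_trans ?_ (le_transition q)
  rw [ENNReal.ofReal_add (quietPart_nonneg _ _ _ _) (n2 q)]
  exact add_le_add (transitionAux_zero_expTest θ k t q.1 q.2).ge
    (le_transitionAux_one hM hθ hR k q)

theorem IsSteadyState.le_integral_quietPart_add (h : IsSteadyState M S μ) (hM : M.IsAdmissible)
    {θ : ℝ} (hθ : 0 ≤ θ) (hR : ∀ d, eventRate M d ≤ R) (hC : ∀ d, M.cap d ≤ C) (k : Fin D)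
    {t : ℝ} (ht : 0 ≤ t) (hRt : R * t ≤ 1 / 2) :
    workloadLaplace S μ θ k ≤ (∫ q, quietPart M θ k t (S.workload q.1, q.2) ∂μ) +
      t * (Real.exp (θ * (C * t)) * ∫ q, jumpPart M θ k (S.workload q.1, q.2) ∂μ)
      + 2 * (R * t) ^ 2 := by
  have := h.prob
  have i1 := integrable_quietPart (μ := μ) hM hθ k ht
  have i2 := ((integrable_jumpPart (μ := μ) (M := M) hθ k).const_mul
    (Real.exp (θ * (C * t)))).const_mul t
  have n2 : ∀ q : S.State × Fin D,
      0 ≤ t * (Real.exp (θ * (C * t)) * jumpPart M θ k (S.workload q.1, q.2)) := fun q =>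
    mul_nonneg ht (mul_nonneg (Real.exp_pos _).le (jumpPart_nonneg hM _ _ _))
  have n3 : ∀ q : S.State × Fin D, 0 ≤ quietPart M θ k t (S.workload q.1, q.2) +
      t * (Real.exp (θ * (C * t)) * jumpPart M θ k (S.workload q.1, q.2)) + 2 * (R * t) ^ 2 :=
    fun q => add_nonneg (add_nonneg (quietPart_nonneg _ _ _ _) (n2 q)) (by positivity)
  have ic : ∫ _, 2 * (R * t) ^ 2 ∂μ = 2 * (R * t) ^ 2 := by simp
  have i12 : Integrable (fun q => quietPart M θ k t (S.workload q.1, q.2) +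
      t * (Real.exp (θ * (C * t)) * jumpPart M θ k (S.workload q.1, q.2))) μ := i1.add i2
  have i3 : Integrable (fun q => quietPart M θ k t (S.workload q.1, q.2) +
      t * (Real.exp (θ * (C * t)) * jumpPart M θ k (S.workload q.1, q.2))
      + 2 * (R * t) ^ 2) μ := i12.add (integrable_const _)
  rw [← integral_const_mul, ← integral_const_mul, ← integral_add i1 i2, ← ic,
    ← integral_add i12 (integrable_const _), workloadLaplace,
    ← ENNReal.ofReal_le_ofReal_iff (integral_nonneg fun q => n3 q),
    ofReal_integral_eq_lintegral_ofReal i3 (.of_forall n3),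
    ofReal_integral_eq_lintegral_ofReal (integrable_expTest hθ k)
      (.of_forall fun _ => expTest_nonneg _ _ _),
    ← h.lintegral_transition θ k ht]
  refine lintegral_mono fun q => (transition_le hM hR (fun r => ?_) ht hRt q).trans ?_
  · exact ENNReal.ofReal_le_one.2 (expTest_le_one hθ _ _)
  rw [ENNReal.ofReal_add (add_nonneg (quietPart_nonneg _ _ _ _) (n2 q)) (by positivity),
    ENNReal.ofReal_add (quietPart_nonneg _ _ _ _) (n2 q)]
  exact add_le_add (add_le_add (transitionAux_zero_expTest θ k t q.1 q.2).le
    (transitionAux_one_le hM hθ hC k q)) le_rfl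

/-- The derivative at time `0` of the contribution of the event that nothing happens. -/
theorem tendsto_integral_quietPart [IsProbabilityMeasure μ] (hM : M.IsAdmissible) {θ : ℝ}
    (hθ : 0 ≤ θ) (k : Fin D) :
    Tendsto (fun t => t⁻¹ * ((∫ q, quietPart M θ k t (S.workload q.1, q.2) ∂μ)
      - workloadLaplace S μ θ k)) (𝓝[>] 0)
      (𝓝 (-eventRate M k * workloadLaplace S μ θ k + M.cap k * θ * (workloadLaplace S μ θ k
        - μ.real {q | S.workload q.1 = 0 ∧ q.2 = k}))) := by
  have hlim : Tendsto (fun t => ∫ q, t⁻¹ * (quietPart M θ k t (S.workload q.1, q.2)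
      - expTest θ k (S.workload q.1, q.2)) ∂μ) (𝓝[>] 0)
      (𝓝 (∫ q, (-eventRate M k * expTest θ k (S.workload q.1, q.2) +
        M.cap k * θ * (expTest θ k (S.workload q.1, q.2) - idle k (S.workload q.1, q.2))) ∂μ)) := by
    refine tendsto_integral_filter_of_dominated_convergence
      (fun _ => eventRate M k + θ * M.cap k) ?_ ?_ (integrable_const _)
      (.of_forall fun q => tendsto_quietPart hM θ k _)
    · exact .of_forall fun t => ((((measurable_quietPart θ k t).sub
        (measurable_expTest θ k)).const_mul t⁻¹).comp
          measurable_workload_prodMk).aestronglyMeasurable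
    · filter_upwards [self_mem_nhdsWithin] with t ht
      have ht : 0 < t := ht
      refine .of_forall fun q => ?_
      rw [Real.norm_eq_abs, abs_mul, abs_of_pos (inv_pos.2 ht), inv_mul_le_iff₀ ht, mul_comm t]
      exact abs_quietPart_sub_le hM hθ k ht.le _
  have i1 : Integrable (fun q => expTest θ k (S.workload q.1, q.2) -
      idle k (S.workload q.1, q.2)) μ := (integrable_expTest hθ k).sub (integrable_idle k)
  rw [integral_add ((integrable_expTest hθ k).const_mul _) (i1.const_mul _), integral_const_mul,
    integral_const_mul, integral_sub (integrable_expTest hθ k) (integrable_idle k),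
    integral_idle] at hlim
  refine hlim.congr' ?_
  filter_upwards [self_mem_nhdsWithin] with t ht
  rw [integral_const_mul, integral_sub (integrable_quietPart hM hθ k (le_of_lt ht))
    (integrable_expTest hθ k), workloadLaplace]

/-- The balance equation for the Laplace transform of the workload in steady state. -/
theorem IsSteadyState.balance (h : IsSteadyState M S μ) (hM : M.IsAdmissible) {θ : ℝ}
    (hθ : 0 ≤ θ) (k : Fin D) :
    M.cap k * θ * (workloadLaplace S μ θ k - μ.real {q | S.workload q.1 = 0 ∧ q.2 = k})
      - M.rate k * (1 - M.serviceLaplace θ k) * workloadLaplace S μ θ k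
      + ∑ d, workloadLaplace S μ θ d * M.gen d k = 0 := by
  have := h.prob
  obtain ⟨R, hR⟩ : ∃ R, ∀ d, eventRate M d ≤ R :=
    ⟨∑ d, eventRate M d, fun d => Finset.single_le_sum
      (fun d _ => hM.eventRate_nonneg d) (Finset.mem_univ d)⟩
  obtain ⟨C, hC⟩ : ∃ C, ∀ d, M.cap d ≤ C :=
    ⟨∑ d, M.cap d, fun d => Finset.single_le_sum
      (fun d _ => hM.cap_nonneg d) (Finset.mem_univ d)⟩
  have hq := tendsto_integral_quietPart (μ := μ) hM hθ k
  set J := ∫ q, jumpPart M θ k (S.workload q.1, q.2) ∂μ with hJ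
  have hid : Tendsto (fun t : ℝ => t) (𝓝[>] 0) (𝓝 0) := nhdsWithin_le_nhds
  have hup : Tendsto (fun t => Real.exp (-(R * t)) * J) (𝓝[>] 0) (𝓝 J) := by
    have : Continuous fun t => Real.exp (-(R * t)) * J := by fun_prop
    simpa using (this.tendsto 0).mono_left nhdsWithin_le_nhds
  have hlow : Tendsto (fun t => Real.exp (θ * (C * t)) * J + 2 * R ^ 2 * t) (𝓝[>] 0) (𝓝 J) := by
    have : Continuous fun t => Real.exp (θ * (C * t)) * J + 2 * R ^ 2 * t := by fun_prop
    simpa using (this.tendsto 0).mono_left nhdsWithin_le_nhds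
  -- The two stationarity inequalities, divided by t, squeeze the derivative at t = 0 between 0 and
  -- 0; the contribution of two or more events becomes 2R²t.
  have h1 := le_of_tendsto (hq.add hup) (b := 0) (by
    filter_upwards [self_mem_nhdsWithin] with t ht
    have ht : 0 < t := ht
    have := h.integral_quietPart_add_le hM hθ hR k ht.le
    rw [← mul_le_mul_iff_right₀ ht, mul_add, mul_inv_cancel_left₀ ht.ne']
    linarith)
  have hRt : ∀ᶠ t in 𝓝[>] (0 : ℝ), R * t < 1 / 2 := by
    have : Continuous fun t => R * t := by fun_prop
    have := (this.tendsto 0).mono_left (nhdsWithin_le_nhds (s := Set.Ioi 0))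
    exact this.eventually_lt_const (by simp)
  have h2 := ge_of_tendsto (hq.add hlow) (b := 0) (by
    filter_upwards [self_mem_nhdsWithin, hRt] with t ht hRt
    have ht : 0 < t := ht
    have := h.le_integral_quietPart_add hM hθ hR hC k ht.le hRt.le
    rw [← mul_le_mul_iff_right₀ ht, mul_add, mul_inv_cancel_left₀ ht.ne']
    nlinarith)
  have h3 := le_antisymm h1 h2
  rw [hJ, integral_jumpPart hθ k, hM.eventRate_eq] at h3
  rw [← Finset.add_sum_erase _ _ (Finset.mem_univ k)]
  simp only [mul_comm (M.gen _ k)] at h3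
  linarith

end Balance

/-! ### From the balance equation to idle probabilities and the mean workload. -/

section Moments

theorem exp_neg_le_quadratic {x : ℝ} (hx : 0 ≤ x) : Real.exp (-x) ≤ 1 - x + x ^ 2 / 2 := by
  have h := Real.quadratic_le_exp_of_nonneg hx
  have hp : 0 < 1 - x + x ^ 2 / 2 := by nlinarith [sq_nonneg (x - 1)]
  rw [Real.exp_neg, inv_le_iff_one_le_mul₀ (Real.exp_pos x)]
  -- Uses (1 - x + x²/2)(1 + x + x²/2) = 1 + x⁴/4 ≥ 1.
  nlinarith [mul_le_mul_of_nonneg_left h hp.le, sq_nonneg (x ^ 2)]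

theorem abs_exp_neg_sub_quadratic_le {x : ℝ} (hx : 0 ≤ x) (hx1 : x ≤ 1) :
    |Real.exp (-x) - 1 + x - x ^ 2 / 2| ≤ x ^ 3 := by
  have h := Real.exp_bound (x := -x) (n := 3) (by rwa [abs_neg, abs_of_nonneg hx]) (by norm_num)
  rw [abs_neg, abs_of_nonneg hx] at h
  norm_num [Finset.sum_range_succ, Nat.factorial] at h
  have e : Real.exp (-x) - 1 + x - x ^ 2 / 2 = Real.exp (-x) - (1 + -x + x ^ 2 / 2) := by ring
  rw [e]
  refine h.trans ?_
  have : 0 ≤ x ^ 3 := by positivity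
  linarith

theorem tendsto_exp_neg_remainder {z : ℝ} (hz : 0 ≤ z) :
    Tendsto (fun θ : ℝ => (Real.exp (-(θ * z)) - 1 + θ * z) / θ ^ 2) (𝓝[>] 0) (𝓝 (z ^ 2 / 2)) := by
  rw [tendsto_iff_norm_sub_tendsto_zero]
  have h0 : Tendsto (fun θ : ℝ => θ * z ^ 3) (𝓝[>] 0) (𝓝 0) := by
    have : Continuous fun θ : ℝ => θ * z ^ 3 := by fun_prop
    simpa using (this.tendsto 0).mono_left nhdsWithin_le_nhds
  have hev : ∀ᶠ θ in 𝓝[>] (0 : ℝ), θ * z < 1 := by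
    have : Continuous fun θ : ℝ => θ * z := by fun_prop
    exact ((this.tendsto 0).mono_left nhdsWithin_le_nhds).eventually_lt_const (by simp)
  refine squeeze_zero' (.of_forall fun _ => norm_nonneg _) ?_ h0
  filter_upwards [hev, self_mem_nhdsWithin] with θ h1 hθ
  have hθ : 0 < θ := hθ
  have h := abs_exp_neg_sub_quadratic_le (mul_nonneg hθ.le hz) h1.le
  have e : (Real.exp (-(θ * z)) - 1 + θ * z) / θ ^ 2 - z ^ 2 / 2
      = (Real.exp (-(θ * z)) - 1 + θ * z - (θ * z) ^ 2 / 2) / θ ^ 2 := by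
    field_simp
  rw [e, Real.norm_eq_abs, abs_div, abs_of_pos (pow_pos hθ 2), div_le_iff₀ (pow_pos hθ 2)]
  exact h.trans_eq (by ring)

variable {D : ℕ} {K : Type*} [MeasurableSpace K] {M : Params D K} {S : ServiceDiscipline K}

theorem Params.IsAdmissible.integrable_service (hM : M.IsAdmissible) (d : Fin D) :
    Integrable (fun z : K × ℝ≥0 => (z.2 : ℝ)) (M.customerLaw d) := by
  have := hM.prob d
  refine Integrable.mono' ((hM.second_moment d).add (integrable_const 1))
    (by fun_prop) (.of_forall fun z => ?_)
  rw [Real.norm_of_nonneg z.2.coe_nonneg, Pi.add_apply]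
  nlinarith [sq_nonneg ((z.2 : ℝ) - 1), z.2.coe_nonneg]

/-- The second-order remainder of the Laplace transform of the service requirement. -/
noncomputable def Params.serviceRemainder (M : Params D K) (θ : ℝ) (d : Fin D) : ℝ :=
  (M.serviceLaplace θ d - 1 + θ * M.h1 d) / θ ^ 2

theorem Params.one_sub_serviceLaplace (M : Params D K) {θ : ℝ} (hθ : θ ≠ 0) (d : Fin D) :
    1 - M.serviceLaplace θ d = θ * M.h1 d - θ ^ 2 * M.serviceRemainder θ d := by
  rw [serviceRemainder]
  field_simp
  ring

theorem Params.IsAdmissible.tendsto_serviceRemainder (hM : M.IsAdmissible) (d : Fin D) :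
    Tendsto (fun θ => M.serviceRemainder θ d) (𝓝[>] 0) (𝓝 (M.h2 d / 2)) := by
  have := hM.prob d
  have hlim : Tendsto (fun θ : ℝ => ∫ z, (Real.exp (-(θ * z.2)) - 1 + θ * z.2) / θ ^ 2
      ∂(M.customerLaw d)) (𝓝[>] 0) (𝓝 (∫ z, (z.2 : ℝ) ^ 2 / 2 ∂(M.customerLaw d))) := by
    refine tendsto_integral_filter_of_dominated_convergence (fun z => (z.2 : ℝ) ^ 2 / 2)
      (.of_forall fun θ => by fun_prop) ?_ ((hM.second_moment d).div_const 2)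
      (.of_forall fun z => tendsto_exp_neg_remainder z.2.coe_nonneg)
    filter_upwards [self_mem_nhdsWithin] with θ hθ
    have hθ : 0 < θ := hθ
    refine .of_forall fun z => ?_
    have h0 : 0 ≤ θ * z.2 := by positivity
    have h1 := Real.one_sub_le_exp_neg (θ * z.2)
    have h2 := exp_neg_le_quadratic h0
    rw [Real.norm_of_nonneg (div_nonneg (by linarith) (by positivity)),
      div_le_iff₀ (by positivity)]
    linarith
  rw [integral_div] at hlim
  refine hlim.congr' ?_
  filter_upwards [self_mem_nhdsWithin] with θ hθ
  have hθ : 0 < θ := hθ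
  have i1 : Integrable (fun z : K × ℝ≥0 => Real.exp (-(θ * z.2)) - 1) (M.customerLaw d) :=
    (integrable_exp_neg hM hθ.le d).sub (integrable_const 1)
  rw [integral_div, integral_add i1 ((hM.integrable_service d).const_mul θ),
    integral_sub (integrable_exp_neg hM hθ.le d) (integrable_const 1), integral_const_mul]
  simp [Params.serviceRemainder, Params.serviceLaplace, Params.h1]

variable {μ : Measure (S.State × Fin D)}

theorem tendsto_workloadLaplace_zero [IsProbabilityMeasure μ] (k : Fin D) :
    Tendsto (fun θ => workloadLaplace S μ θ k) (𝓝[>] 0) (𝓝 (workloadLaplace S μ 0 k)) := by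
  refine tendsto_integral_filter_of_dominated_convergence (fun _ => 1)
    (.of_forall fun θ =>
      ((measurable_expTest θ k).comp measurable_workload_prodMk).aestronglyMeasurable)
    ?_ (integrable_const 1) (.of_forall fun q => ?_)
  · filter_upwards [self_mem_nhdsWithin] with θ hθ
    refine .of_forall fun q => ?_
    rw [Real.norm_of_nonneg (expTest_nonneg _ _ _)]
    exact expTest_le_one (le_of_lt hθ) _ _
  · have : Continuous fun θ => expTest θ k (S.workload q.1, q.2) := by
      unfold expTest
      split_ifs <;> fun_prop
    exact (this.tendsto 0).mono_left nhdsWithin_le_nhds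

theorem tendsto_workloadLaplace_atTop [IsProbabilityMeasure μ] (k : Fin D) :
    Tendsto (fun θ => workloadLaplace S μ θ k) atTop
      (𝓝 (μ.real {q | S.workload q.1 = 0 ∧ q.2 = k})) := by
  rw [← integral_idle]
  refine tendsto_integral_filter_of_dominated_convergence (fun _ => 1)
    (.of_forall fun θ =>
      ((measurable_expTest θ k).comp measurable_workload_prodMk).aestronglyMeasurable)
    ?_ (integrable_const 1) (.of_forall fun q => ?_)
  · filter_upwards [eventually_ge_atTop 0] with θ hθ
    refine .of_forall fun q => ?_
    rw [Real.norm_of_nonneg (expTest_nonneg _ _ _)]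
    exact expTest_le_one hθ _ _
  · unfold expTest idle
    dsimp only
    by_cases hk : q.2 = k
    · by_cases hw : S.workload q.1 = 0
      · simp [hk, hw]
      · simp only [hk, hw, if_true, false_and, if_false]
        have hw0 : (0 : ℝ) < S.workload q.1 := NNReal.coe_pos.2 (pos_iff_ne_zero.2 hw)
        exact Real.tendsto_exp_neg_atTop_nhds_zero.comp (tendsto_id.atTop_mul_const hw0)
    · simp [hk]

theorem sum_workloadLaplace [IsProbabilityMeasure μ] {θ : ℝ} (hθ : 0 ≤ θ) :
    ∑ k, workloadLaplace S μ θ k = ∫ q, Real.exp (-(θ * S.workload q.1)) ∂μ := by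
  simp only [workloadLaplace]
  rw [← integral_finsetSum _ fun k _ => integrable_expTest hθ k]
  refine integral_congr_ae (.of_forall fun q => ?_)
  simp [expTest]

theorem serviceLaplace_zero (hM : M.IsAdmissible) (d : Fin D) : M.serviceLaplace 0 d = 1 := by
  have := hM.prob d
  simp [Params.serviceLaplace]

variable {p : Fin D → ℝ}

/-- In steady state the environment has its invariant distribution. -/
theorem IsSteadyState.workloadLaplace_zero (h : IsSteadyState M S μ) (hM : M.IsAdmissible)
    (hp : IsInvariant M.gen p) : workloadLaplace S μ 0 = p := by
  have := h.prob
  refine hp.eq_of_balance hM.generator hM.irreducible ?_ fun k => ?_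
  · rw [sum_workloadLaplace le_rfl]
    simp
  -- At θ = 0 the service and arrival terms vanish and the balance equation reduces to invariance
  -- under Q.
  · have := h.balance hM le_rfl k
    rw [serviceLaplace_zero hM] at this
    simpa using this

/-- Flow into an environment state of an idle server is at most the flow out of it. -/
theorem IsSteadyState.sum_idle_mul_gen_le (h : IsSteadyState M S μ) (hM : M.IsAdmissible)
    (k : Fin D) :
    ∑ d, μ.real {q | S.workload q.1 = 0 ∧ q.2 = d} * M.gen d k ≤
      M.rate k * μ.real {q | S.workload q.1 = 0 ∧ q.2 = k} := by
  have := h.prob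
  refine le_of_tendsto_of_tendsto
    (tendsto_finsetSum _ fun d _ => (tendsto_workloadLaplace_atTop d).mul_const _)
    ((tendsto_workloadLaplace_atTop k).const_mul _) ?_
  filter_upwards [eventually_ge_atTop 0] with θ hθ
  have hb := h.balance hM hθ k
  have h1 : μ.real {q | S.workload q.1 = 0 ∧ q.2 = k} ≤ workloadLaplace S μ θ k := by
    rw [← integral_idle]
    exact integral_mono (integrable_idle k) (integrable_expTest hθ k)
      fun q => idle_le_expTest _ _ _
  -- Before θ → ∞, two nonnegative terms are discarded: the capacity term, in which the factor θ is
  -- unbounded, and the arrival term with Ĥ_k, whose limit need not vanish if service requirements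
  -- can be zero. An inequality is all that remains, and all that is needed.
  have h2 := mul_nonneg (mul_nonneg (hM.cap_nonneg k) hθ) (sub_nonneg.2 h1)
  have h3 : 0 ≤ M.rate k * M.serviceLaplace θ k * workloadLaplace S μ θ k :=
    mul_nonneg (mul_nonneg (hM.rate_nonneg k) (M.serviceLaplace_nonneg θ k))
      (integral_nonneg fun _ => expTest_nonneg _ _ _)
  linarith

theorem IsSteadyState.balance_div (h : IsSteadyState M S μ) (hM : M.IsAdmissible) {θ : ℝ}
    (hθ : 0 < θ) (k : Fin D) :
    θ * (M.cap k * (workloadLaplace S μ θ k - μ.real {q | S.workload q.1 = 0 ∧ q.2 = k})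
      - M.rate k * (M.h1 k - θ * M.serviceRemainder θ k) * workloadLaplace S μ θ k)
      + ∑ d, workloadLaplace S μ θ d * M.gen d k = 0 := by
  have hb := h.balance hM hθ.le k
  rw [M.one_sub_serviceLaplace hθ.ne'] at hb
  linarith

/-- Pairing the vector equation with `b` transfers Q from the unknown transforms to `b`, which can
then be chosen: constant, or a solution of a Poisson equation. -/
theorem IsSteadyState.sum_balance (h : IsSteadyState M S μ) (hM : M.IsAdmissible) {θ : ℝ}
    (hθ : 0 < θ) (b : Fin D → ℝ) :
    θ * ∑ k, b k * (M.cap k * (workloadLaplace S μ θ k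
          - μ.real {q | S.workload q.1 = 0 ∧ q.2 = k})
        - M.rate k * (M.h1 k - θ * M.serviceRemainder θ k) * workloadLaplace S μ θ k)
      + ∑ d, workloadLaplace S μ θ d * M.gen.mulVec b d = 0 := by
  have e : ∑ d, workloadLaplace S μ θ d * M.gen.mulVec b d =
      ∑ k, b k * ∑ d, workloadLaplace S μ θ d * M.gen d k := by
    simp only [Matrix.mulVec, dotProduct, Finset.mul_sum]
    rw [Finset.sum_comm]
    exact Finset.sum_congr rfl fun _ _ => Finset.sum_congr rfl fun _ _ => by ring
  rw [e, Finset.mul_sum, ← Finset.sum_add_distrib]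
  refine Finset.sum_eq_zero fun k _ => ?_
  have := congrArg (b k * ·) (h.balance_div hM hθ k)
  simp only [mul_zero] at this
  linarith

theorem IsSteadyState.tendsto_weighted (h : IsSteadyState M S μ) (hM : M.IsAdmissible)
    (hp : IsInvariant M.gen p) (k : Fin D) :
    Tendsto (fun θ => M.cap k * (workloadLaplace S μ θ k
          - μ.real {q | S.workload q.1 = 0 ∧ q.2 = k})
        - M.rate k * (M.h1 k - θ * M.serviceRemainder θ k) * workloadLaplace S μ θ k) (𝓝[>] 0)
      (𝓝 (M.cap k * (p k - μ.real {q | S.workload q.1 = 0 ∧ q.2 = k})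
        - M.rate k * M.h1 k * p k)) := by
  have := h.prob
  have hφ := tendsto_workloadLaplace_zero (S := S) (μ := μ) k
  rw [h.workloadLaplace_zero hM hp] at hφ
  have hid : Tendsto (fun θ : ℝ => θ) (𝓝[>] 0) (𝓝 0) := nhdsWithin_le_nhds
  have hg := hid.mul (hM.tendsto_serviceRemainder k)
  rw [zero_mul] at hg
  have := ((hφ.sub_const (μ.real {q | S.workload q.1 = 0 ∧ q.2 = k})).const_mul (M.cap k)).sub
    (((hg.const_sub (M.h1 k)).const_mul (M.rate k)).mul hφ)
  simpa using this

/-- In steady state the average unused capacity is the difference of capacity and load. -/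
theorem IsSteadyState.sum_cap_mul_idle (h : IsSteadyState M S μ) (hM : M.IsAdmissible)
    (hp : IsInvariant M.gen p) :
    ∑ k, M.cap k * μ.real {q | S.workload q.1 = 0 ∧ q.2 = k} =
      ∑ k, p k * (M.cap k - M.rate k * M.h1 k) := by
  have hlim := tendsto_finsetSum Finset.univ fun k _ => h.tendsto_weighted hM hp k
  have h0 : ∀ᶠ θ in 𝓝[>] (0 : ℝ), ∑ k, (M.cap k * (workloadLaplace S μ θ k
          - μ.real {q | S.workload q.1 = 0 ∧ q.2 = k})
        - M.rate k * (M.h1 k - θ * M.serviceRemainder θ k) * workloadLaplace S μ θ k) = 0 := by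
    filter_upwards [self_mem_nhdsWithin] with θ hθ
    have hθ : 0 < θ := hθ
    -- With the constant weight the Q-term disappears, so the remaining factor θ can be divided out.
    have hQ : M.gen.mulVec (fun _ => 1) = 0 := funext fun d => by
      simpa [Matrix.mulVec, dotProduct] using hM.generator.row_sum d
    have := h.sum_balance hM hθ fun _ => 1
    rw [hQ] at this
    simpa [hθ.ne'] using this
  have h1 := tendsto_nhds_unique (hlim.congr' h0) tendsto_const_nhds
  rw [← sub_eq_zero, ← neg_eq_zero, ← h1, ← Finset.sum_sub_distrib, ← Finset.sum_neg_distrib]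
  exact Finset.sum_congr rfl fun k _ => by ring

theorem tendsto_one_sub_exp_neg_div (w : ℝ) :
    Tendsto (fun θ : ℝ => (1 - Real.exp (-(θ * w))) / θ) (𝓝[>] 0) (𝓝 w) := by
  have hd : HasDerivAt (fun θ : ℝ => -Real.exp (-(θ * w))) w 0 := by
    have h1 : HasDerivAt (fun θ : ℝ => -(θ * w)) (-w) 0 := by
      simpa using (hasDerivAt_id' (0 : ℝ)).mul_const (-w)
    exact h1.exp.neg.congr_deriv (by simp)
  refine hd.tendsto_slope_zero_right.congr fun θ => ?_
  simp only [zero_add, zero_mul, neg_zero, Real.exp_zero, smul_eq_mul]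
  ring

/-- A nonnegative random variable has a finite mean if the difference quotients of its Laplace
transform at `0` converge, and then the limit is the mean. -/
theorem integrable_and_integral_eq_of_tendsto {Ω : Type*} [MeasurableSpace Ω] {μ : Measure Ω}
    [IsProbabilityMeasure μ] {X : Ω → ℝ≥0} (hX : Measurable X) {L : ℝ}
    (hL : Tendsto (fun θ : ℝ => (1 - ∫ ω, Real.exp (-(θ * X ω)) ∂μ) / θ) (𝓝[>] 0) (𝓝 L)) :
    Integrable (fun ω => (X ω : ℝ)) μ ∧ ∫ ω, (X ω : ℝ) ∂μ = L := by
  have hexp : ∀ θ : ℝ, 0 < θ → Integrable (fun ω => (1 - Real.exp (-(θ * X ω))) / θ) μ ∧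
      (1 - ∫ ω, Real.exp (-(θ * X ω)) ∂μ) / θ = ∫ ω, (1 - Real.exp (-(θ * X ω))) / θ ∂μ := by
    intro θ hθ
    have i1 : Integrable (fun ω => Real.exp (-(θ * X ω))) μ := by
      refine Integrable.of_bound (C := 1) (by fun_prop) (.of_forall fun ω => ?_)
      rw [Real.norm_of_nonneg (Real.exp_pos _).le, Real.exp_le_one_iff, neg_nonpos]
      positivity
    refine ⟨((integrable_const 1).sub i1).div_const θ, ?_⟩
    rw [integral_div, integral_sub (integrable_const 1) i1]
    simp
  have hbd : ∀ θ : ℝ, 0 < θ → ∀ ω, 0 ≤ (1 - Real.exp (-(θ * X ω))) / θ ∧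
      (1 - Real.exp (-(θ * X ω))) / θ ≤ X ω := by
    intro θ hθ ω
    have h1 := Real.one_sub_le_exp_neg (θ * X ω)
    have h2 : Real.exp (-(θ * X ω)) ≤ 1 := by
      rw [Real.exp_le_one_iff, neg_nonpos]; positivity
    refine ⟨div_nonneg (by linarith) hθ.le, ?_⟩
    rw [div_le_iff₀ hθ]
    linarith
  have hu : Tendsto (fun n : ℕ => 1 / ((n : ℝ) + 1)) atTop (𝓝[>] 0) :=
    tendsto_nhdsWithin_iff.2 ⟨tendsto_one_div_add_atTop_nhds_zero_nat,
      .of_forall fun n => by simp only [Set.mem_Ioi]; positivity⟩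
  have hint : Integrable (fun ω => (X ω : ℝ)) μ := by
    refine ⟨by fun_prop, ?_⟩
    rw [hasFiniteIntegral_iff_ofReal (.of_forall fun ω => (X ω).coe_nonneg)]
    -- Fatou's lemma along θ = 1/(n + 1) gives finiteness of the mean first; `X` can then serve as
    -- the dominating function that identifies the limit.
    have hpt : ∀ ω, ENNReal.ofReal (X ω) = liminf (fun n : ℕ => ENNReal.ofReal
        ((1 - Real.exp (-(1 / ((n : ℝ) + 1) * X ω))) / (1 / ((n : ℝ) + 1)))) atTop := fun ω =>
      (ENNReal.tendsto_ofReal ((tendsto_one_sub_exp_neg_div (X ω)).comp hu)).liminf_eq.symm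
    have hlim : Tendsto (fun n : ℕ => ∫⁻ ω, ENNReal.ofReal
        ((1 - Real.exp (-(1 / ((n : ℝ) + 1) * X ω))) / (1 / ((n : ℝ) + 1))) ∂μ) atTop
        (𝓝 (ENNReal.ofReal L)) := by
      refine (ENNReal.tendsto_ofReal (hL.comp hu)).congr fun n => ?_
      have hn : (0 : ℝ) < 1 / ((n : ℝ) + 1) := by positivity
      rw [Function.comp_apply, (hexp _ hn).2, ofReal_integral_eq_lintegral_ofReal (hexp _ hn).1
        (.of_forall fun ω => (hbd _ hn ω).1)]
    calc ∫⁻ ω, ENNReal.ofReal (X ω) ∂μ ≤ _ := by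
          simp only [hpt]
          exact lintegral_liminf_le fun n => by fun_prop
      _ = ENNReal.ofReal L := hlim.liminf_eq
      _ < ⊤ := ENNReal.ofReal_lt_top
  refine ⟨hint, tendsto_nhds_unique (f := fun θ : ℝ =>
    ∫ ω, (1 - Real.exp (-(θ * X ω))) / θ ∂μ) (l := 𝓝[>] 0) ?_ (hL.congr' ?_)⟩
  · refine tendsto_integral_filter_of_dominated_convergence (fun ω => (X ω : ℝ))
      (.of_forall fun θ => by fun_prop) ?_ hint
      (.of_forall fun ω => tendsto_one_sub_exp_neg_div (X ω))
    filter_upwards [self_mem_nhdsWithin] with θ hθ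
    refine .of_forall fun ω => ?_
    rw [Real.norm_of_nonneg (hbd θ hθ ω).1]
    exact (hbd θ hθ ω).2
  · filter_upwards [self_mem_nhdsWithin] with θ hθ
    exact (hexp θ hθ).2

/-- The mean workload in steady state. -/
theorem IsSteadyState.integrable_and_integral_workload (h : IsSteadyState M S μ)
    (hM : M.IsAdmissible) (hp : IsInvariant M.gen p) {ε : ℝ} (hε : 0 < ε) {b : Fin D → ℝ}
    (hb : ∀ d, M.gen.mulVec b d = M.cap d - M.rate d * M.h1 d - ε) :
    Integrable (fun q => (S.workload q.1 : ℝ)) μ ∧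
    ε * ∫ q, (S.workload q.1 : ℝ) ∂μ =
      ∑ k, (M.rate k * (M.h2 k / 2) * p k
        - b k * (M.cap k * (p k - μ.real {q | S.workload q.1 = 0 ∧ q.2 = k})
          - M.rate k * M.h1 k * p k)) := by
  have := h.prob
  -- Solvability of the equation for `b` forces ε: pairing it with p shows that ε is the mean drift
  -- deficit, which is the mean unused capacity.
  have hεp : ε = ∑ k, M.cap k * μ.real {q | S.workload q.1 = 0 ∧ q.2 = k} := by
    have h0 := hp.sum_mul_mulVec b
    simp only [hb, mul_sub _ _ ε, Finset.sum_sub_distrib, ← Finset.sum_mul, hp.sum_eq_one] at h0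
    rw [h.sum_cap_mul_idle hM hp]
    linarith
  set L := ∑ k, (M.rate k * (M.h2 k / 2) * p k
        - b k * (M.cap k * (p k - μ.real {q | S.workload q.1 = 0 ∧ q.2 = k})
          - M.rate k * M.h1 k * p k)) with hLdef
  have hφ := fun k => tendsto_workloadLaplace_zero (S := S) (μ := μ) k
  rw [h.workloadLaplace_zero hM hp] at hφ
  have hlim := (tendsto_finsetSum Finset.univ fun k _ =>
    (((hM.tendsto_serviceRemainder k).const_mul (M.rate k)).mul (hφ k)).sub
      ((h.tendsto_weighted hM hp k).const_mul (b k))).const_mul ε⁻¹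
  rw [← hLdef] at hlim
  have hL := integrable_and_integral_eq_of_tendsto (μ := μ)
    (S.measurable_workload.comp measurable_fst) (hlim.congr' (by
      filter_upwards [self_mem_nhdsWithin] with θ hθ
      have hθ : 0 < θ := hθ
      have h1 := h.sum_balance hM hθ b
      have h2 := h.sum_balance hM hθ fun _ => 1
      have hQ : M.gen.mulVec (fun _ => 1) = 0 := funext fun d => by
        simpa [Matrix.mulVec, dotProduct] using hM.generator.row_sum d
      rw [hQ] at h2
      simp only [Pi.zero_apply, mul_zero, Finset.sum_const_zero, add_zero, one_mul,
        mul_eq_zero, hθ.ne', false_or] at h2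
      have h3 := sum_workloadLaplace (S := S) (μ := μ) hθ.le
      rw [eq_div_iff hθ.ne', mul_assoc, inv_mul_eq_iff_eq_mul₀ hε.ne']
      simp only [Function.comp_apply]
      rw [← h3, mul_sub, mul_one]
      nth_rewrite 1 [hεp]
      simp only [hb] at h1
      rw [Finset.mul_sum] at h1 ⊢
      rw [Finset.sum_mul, ← Finset.sum_sub_distrib]
      -- In the difference of the identities for `b` and for the constant 1, the terms φ_k (c_k -
      -- λ_k h_{k1}) cancel. What is left is ε (1 - ∑ φ_k) as an explicit multiple of θ.
      have h4 := congrArg₂ (· - ·) h1 h2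
      simp only [sub_zero] at h4
      rw [← sub_eq_zero, ← neg_eq_zero, ← h4, ← Finset.sum_add_distrib, ← Finset.sum_sub_distrib,
        ← Finset.sum_sub_distrib, ← Finset.sum_neg_distrib]
      refine Finset.sum_congr rfl fun k _ => ?_
      ring))
  refine ⟨hL.1, ?_⟩
  have := hL.2
  simp only [Function.comp_apply] at this
  rw [this, mul_inv_cancel_left₀ hε.ne']

end Moments

/-! ### The heavy traffic limit. -/

section HeavyTraffic

variable {D : ℕ} {K : Type*} [MeasurableSpace K] {M : Params D K} {S : ServiceDiscipline K}
  {p : Fin D → ℝ}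

theorem Params.IsAdmissible.rateHat_nonneg (hM : M.IsAdmissible) (hload : 0 < M.load p)
    (d : Fin D) : 0 ≤ M.rateHat p d :=
  div_nonneg (hM.rate_nonneg d) hload.le

theorem Params.IsAdmissible.scaled (hM : M.IsAdmissible) (hload : 0 < M.load p) {N : ℝ}
    (hN : 1 < N) : (M.scaled p N).IsAdmissible where
  generator := hM.generator
  irreducible := hM.irreducible
  rate_nonneg d := mul_nonneg (hM.rateHat_nonneg hload d)
    (sub_nonneg.2 ((div_le_one (by linarith)).2 hN.le))
  cap_nonneg := hM.cap_nonneg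
  prob := hM.prob
  second_moment := hM.second_moment

/-- At the critical arrival rates the average load equals the average capacity. -/
theorem Params.sum_rateHat_mul_h1 (hcap : 0 < M.capAvg p) (hload : 0 < M.load p) :
    ∑ d, p d * (M.rateHat p d * M.h1 d) = M.capAvg p := by
  have h : (∑ d, p d * M.rate d * M.h1 d) = M.load p * M.capAvg p := by
    rw [Params.load, div_mul_cancel₀ _ hcap.ne']
  calc _ = (∑ d, p d * M.rate d * M.h1 d) / M.load p := by
        rw [Finset.sum_div]
        exact Finset.sum_congr rfl fun d _ => by rw [Params.rateHat]; ring
    _ = _ := by rw [h, mul_div_cancel_left₀ _ hload.ne']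

theorem Params.IsAdmissible.exists_mulVec_critical (hM : M.IsAdmissible)
    (hp : IsInvariant M.gen p) (hcap : 0 < M.capAvg p) (hload : 0 < M.load p) :
    ∃ a : Fin D → ℝ, ∀ d, M.gen.mulVec a d = M.cap d - M.rateHat p d * M.h1 d := by
  obtain ⟨a, ha⟩ := hM.generator.exists_mulVec_eq hM.irreducible hp
    (v := fun d => M.cap d - M.rateHat p d * M.h1 d) (by
      simp only [mul_sub, Finset.sum_sub_distrib, Params.sum_rateHat_mul_h1 hcap hload]
      exact sub_self _)
  exact ⟨a, congrFun ha⟩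

theorem Params.IsAdmissible.exists_mulVec_correction (hM : M.IsAdmissible)
    (hp : IsInvariant M.gen p) (hcap : 0 < M.capAvg p) (hload : 0 < M.load p) :
    ∃ a : Fin D → ℝ, ∀ d, M.gen.mulVec a d = M.rateHat p d * M.h1 d - M.capAvg p := by
  obtain ⟨a, ha⟩ := hM.generator.exists_mulVec_eq hM.irreducible hp
    (v := fun d => M.rateHat p d * M.h1 d - M.capAvg p) (by
      simp only [mul_sub, Finset.sum_sub_distrib, Params.sum_rateHat_mul_h1 hcap hload,
        ← Finset.sum_mul, hp.sum_eq_one]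
      ring)
  exact ⟨a, congrFun ha⟩

/-- Lowering the arrival rates by the factor 1 - 1/N adds λ̂h/N to the critical right-hand side c -
λ̂h. Its mean c_∞/N has to be subtracted for solvability and becomes ε, while `a'` solves for the
centred part; so the solution is an O(1/N) perturbation of `a`. -/
theorem mulVec_add_smul_correction {a a' : Fin D → ℝ}
    (ha : ∀ d, M.gen.mulVec a d = M.cap d - M.rateHat p d * M.h1 d)
    (ha' : ∀ d, M.gen.mulVec a' d = M.rateHat p d * M.h1 d - M.capAvg p) (N : ℝ) (d : Fin D) :
    (M.scaled p N).gen.mulVec (a + (1 / N) • a') d = (M.scaled p N).cap d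
      - (M.scaled p N).rate d * (M.scaled p N).h1 d - M.capAvg p / N := by
  change M.gen.mulVec (a + (1 / N) • a') d
    = M.cap d - M.rateHat p d * (1 - 1 / N) * M.h1 d - M.capAvg p / N
  rw [Matrix.mulVec_add, Matrix.mulVec_smul, Pi.add_apply, Pi.smul_apply, ha, ha', smul_eq_mul]
  ring

variable {μ : ℝ → Measure (S.State × Fin D)}

/-- The mean workload of the scaled queue. -/
theorem integrable_and_integral_workload_scaled (hM : M.IsAdmissible) (hp : IsInvariant M.gen p)
    (hcap : 0 < M.capAvg p) (hload : 0 < M.load p)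
    (hμ : ∀ N : ℝ, 1 < N → IsSteadyState (M.scaled p N) S (μ N)) {a a' : Fin D → ℝ}
    (ha : ∀ d, M.gen.mulVec a d = M.cap d - M.rateHat p d * M.h1 d)
    (ha' : ∀ d, M.gen.mulVec a' d = M.rateHat p d * M.h1 d - M.capAvg p) {N : ℝ} (hN : 1 < N) :
    Integrable (fun q => (S.workload q.1 : ℝ)) (μ N) ∧
    1 / N * ∫ q, (S.workload q.1 : ℝ) ∂(μ N) = 1 / M.capAvg p *
      ∑ k, (M.rateHat p k * (1 - 1 / N) * (M.h2 k / 2) * p k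
        - (a k + 1 / N * a' k) *
          (M.cap k * (p k - (μ N).real {q | S.workload q.1 = 0 ∧ q.2 = k})
          - M.rateHat p k * (1 - 1 / N) * M.h1 k * p k)) := by
  have hN0 : 0 < N := by linarith
  obtain ⟨h1, h2⟩ := (hμ N hN).integrable_and_integral_workload (hM.scaled hload hN) hp
    (div_pos hcap hN0) (mulVec_add_smul_correction ha ha' N)
  refine ⟨h1, ?_⟩
  have h3 : M.capAvg p / N * ∫ q, (S.workload q.1 : ℝ) ∂(μ N) =
      ∑ k, (M.rateHat p k * (1 - 1 / N) * (M.h2 k / 2) * p k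
        - (a k + 1 / N * a' k) *
          (M.cap k * (p k - (μ N).real {q | S.workload q.1 = 0 ∧ q.2 = k})
          - M.rateHat p k * (1 - 1 / N) * M.h1 k * p k)) := h2
  rw [← h3]
  field_simp

/-- In heavy traffic the server is rarely idle. -/
theorem tendsto_idle (hM : M.IsAdmissible) (hp : IsInvariant M.gen p)
    (hcap : 0 < M.capAvg p) (hload : 0 < M.load p)
    (hμ : ∀ N : ℝ, 1 < N → IsSteadyState (M.scaled p N) S (μ N)) (d : Fin D) :
    Tendsto (fun N : ℝ => (μ N).real {q | S.workload q.1 = 0 ∧ q.2 = d}) atTop (𝓝 0) := by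
  obtain ⟨m, hm⟩ : ∃ m, 0 < M.cap m := by
    by_contra! h
    refine hcap.not_ge (Finset.sum_nonpos fun d _ => ?_)
    exact mul_nonpos_of_nonneg_of_nonpos (hp.nonneg d) (h d)
  -- Backwards along a path from `d` to a state `m` of positive capacity. At `m` itself, c_m p_{0,m}
  -- is at most the total unused capacity c_∞/N.
  induction hM.irreducible d m using Relation.ReflTransGen.head_induction_on with
  | refl =>
    have h0 : Tendsto (fun N : ℝ => M.capAvg p / M.cap m / N) atTop (𝓝 0) :=
      tendsto_const_nhds.div_atTop tendsto_id
    refine squeeze_zero' (.of_forall fun N => measureReal_nonneg) ?_ h0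
    filter_upwards [eventually_gt_atTop 1] with N hN
    have h1 : ∑ k, M.cap k * (μ N).real {q | S.workload q.1 = 0 ∧ q.2 = k} =
      ∑ k, p k * (M.cap k - M.rateHat p k * (1 - 1 / N) * M.h1 k) :=
      (hμ N hN).sum_cap_mul_idle (hM.scaled hload hN) hp
    have h2 : ∑ k, p k * (M.cap k - M.rateHat p k * (1 - 1 / N) * M.h1 k) = M.capAvg p / N := by
      have e : ∀ k, p k * (M.cap k - M.rateHat p k * (1 - 1 / N) * M.h1 k) =
          p k * M.cap k - (1 - 1 / N) * (p k * (M.rateHat p k * M.h1 k)) := fun k => by ring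
      simp only [e, Finset.sum_sub_distrib, ← Finset.mul_sum,
        Params.sum_rateHat_mul_h1 hcap hload]
      change M.capAvg p - _ = _
      ring
    have h3 := Finset.single_le_sum (f := fun k =>
      M.cap k * (μ N).real {q | S.workload q.1 = 0 ∧ q.2 = k})
      (fun k _ => mul_nonneg (hM.cap_nonneg k) measureReal_nonneg) (Finset.mem_univ m)
    rw [h1, h2] at h3
    rw [div_right_comm, le_div_iff₀ hm]
    linarith
  | @head i j hij _ ih =>
    -- Idle probability in `i` flows into `j` at rate Q_{ij} > 0 and can leave `j` at rate at most
    -- λ̂_j - Q_{jj}, so p_{0,i} is bounded by a constant multiple of p_{0,j}.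
    have h0 := ih.const_mul ((M.rateHat p j - M.gen j j) / M.gen i j)
    rw [mul_zero] at h0
    refine squeeze_zero' (.of_forall fun N => measureReal_nonneg) ?_ h0
    filter_upwards [eventually_gt_atTop 1] with N hN
    have h1 : ∑ d, (μ N).real {q | S.workload q.1 = 0 ∧ q.2 = d} * M.gen d j ≤
        M.rateHat p j * (1 - 1 / N) * (μ N).real {q | S.workload q.1 = 0 ∧ q.2 = j} :=
      (hμ N hN).sum_idle_mul_gen_le (hM.scaled hload hN) j
    rw [← Finset.add_sum_erase _ _ (Finset.mem_univ j)] at h1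
    have h2 := Finset.single_le_sum (f := fun d =>
      (μ N).real {q | S.workload q.1 = 0 ∧ q.2 = d} * M.gen d j)
      (fun d hd => mul_nonneg measureReal_nonneg
        (hM.generator.off_diag_nonneg d j (Finset.ne_of_mem_erase hd)))
      (Finset.mem_erase.2 ⟨hij.1, Finset.mem_univ i⟩)
    have h3 : M.rateHat p j * (1 - 1 / N) * (μ N).real {q | S.workload q.1 = 0 ∧ q.2 = j} ≤
        M.rateHat p j * (μ N).real {q | S.workload q.1 = 0 ∧ q.2 = j} := by
      refine mul_le_mul_of_nonneg_right ?_ measureReal_nonneg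
      refine mul_le_of_le_one_right (hM.rateHat_nonneg hload j) ?_
      have : 0 ≤ 1 / N := by positivity
      linarith
    rw [div_mul_eq_mul_div, le_div_iff₀ hij.2]
    linarith

/-- The heavy traffic limit of the mean workload. -/
theorem tendsto_mean_workload (hM : M.IsAdmissible) (hp : IsInvariant M.gen p)
    (hcap : 0 < M.capAvg p) (hload : 0 < M.load p)
    (hμ : ∀ N : ℝ, 1 < N → IsSteadyState (M.scaled p N) S (μ N)) {a : Fin D → ℝ}
    (ha : ∀ d, M.gen.mulVec a d = M.cap d - M.rateHat p d * M.h1 d) :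
    Tendsto (fun N : ℝ => 1 / N * ∫ q, (S.workload q.1 : ℝ) ∂(μ N)) atTop
      (𝓝 (1 / M.capAvg p * ∑ d, p d *
        (M.rateHat p d * M.h2 d / 2 + a d * (M.rateHat p d * M.h1 d - M.cap d)))) := by
  obtain ⟨a', ha'⟩ := hM.exists_mulVec_correction hp hcap hload
  have hinv : Tendsto (fun N : ℝ => 1 / N) atTop (𝓝 0) := tendsto_const_nhds.div_atTop tendsto_id
  have hrate : ∀ k, Tendsto (fun N : ℝ => M.rateHat p k * (1 - 1 / N)) atTop
      (𝓝 (M.rateHat p k)) := fun k => by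
    simpa using (hinv.const_sub 1).const_mul (M.rateHat p k)
  have hb : ∀ k, Tendsto (fun N : ℝ => a k + 1 / N * a' k) atTop (𝓝 (a k)) := fun k => by
    simpa using (hinv.mul_const (a' k)).const_add (a k)
  have hlim := (tendsto_finsetSum Finset.univ fun k _ =>
    (((hrate k).mul_const (M.h2 k / 2)).mul_const (p k)).sub
      ((hb k).mul ((((tendsto_idle hM hp hcap hload hμ k).const_sub (p k)).const_mul
        (M.cap k)).sub (((hrate k).mul_const (M.h1 k)).mul_const (p k))))).const_mul
    (1 / M.capAvg p)
  -- The 0 in `p k - 0` is the limit of the idle probability, kept so that the expression matches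
  -- the exact formula term by term.
  have e : ∑ d, p d * (M.rateHat p d * M.h2 d / 2 + a d * (M.rateHat p d * M.h1 d - M.cap d)) =
      ∑ k, (M.rateHat p k * (M.h2 k / 2) * p k
        - a k * (M.cap k * (p k - 0) - M.rateHat p k * M.h1 k * p k)) :=
    Finset.sum_congr rfl fun k _ => by ring
  rw [e]
  refine hlim.congr' ?_
  filter_upwards [eventually_gt_atTop 1] with N hN
  exact (integrable_and_integral_workload_scaled hM hp hcap hload hμ ha ha' hN).2.symm

end HeavyTraffic

end ModulatedQueue

theorem mainTheorem4 {D : ℕ} {K : Type*} [MeasurableSpace K]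
    (M : ModulatedQueue.Params D K) (hM : M.IsAdmissible)
    (p : Fin D → ℝ) (hp : ModulatedQueue.IsInvariant M.gen p)
    (hcap : 0 < M.capAvg p) (hload : 0 < M.load p)
    (S : ModulatedQueue.ServiceDiscipline K)
    (μ : ℝ → Measure (S.State × Fin D))
    (hμ : ∀ N : ℝ, 1 < N → ModulatedQueue.IsSteadyState (M.scaled p N) S (μ N)) :
    (∃ a : Fin D → ℝ, ∀ d, M.gen.mulVec a d = M.cap d - M.rateHat p d * M.h1 d) ∧
    (∀ N : ℝ, 1 < N → Integrable (fun q => (S.workload q.1 : ℝ)) (μ N)) ∧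
    (∀ d, Tendsto (fun N : ℝ => (μ N).real {q | S.workload q.1 = 0 ∧ q.2 = d}) atTop (𝓝 0)) ∧
    (∀ a : Fin D → ℝ, (∀ d, M.gen.mulVec a d = M.cap d - M.rateHat p d * M.h1 d) →
      Tendsto (fun N : ℝ => 1 / N * ∫ q, (S.workload q.1 : ℝ) ∂(μ N)) atTop
        (𝓝 (1 / M.capAvg p * ∑ d, p d *
          (M.rateHat p d * M.h2 d / 2 + a d * (M.rateHat p d * M.h1 d - M.cap d))))) := by
  obtain ⟨a, ha⟩ := hM.exists_mulVec_critical hp hcap hload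
  obtain ⟨a', ha'⟩ := hM.exists_mulVec_correction hp hcap hload
  exact ⟨⟨a, ha⟩,
    fun N hN => (ModulatedQueue.integrable_and_integral_workload_scaled hM hp hcap hload hμ
      ha ha' hN).1,
    ModulatedQueue.tendsto_idle hM hp hcap hload hμ,
    fun a ha => ModulatedQueue.tendsto_mean_workload hM hp hcap hload hμ ha⟩
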